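/- **Setting.** Let $n\ge 2$ agents minimize $f(x)=\frac1n\sum_{i=1}^n f_i(x)$ over $x\in\mathbb{R}^d$, $d\ge1$. $\|\cdot\|$ is the Euclidean norm and $\|\cdot\|_p$ the $\ell_p$-norm, $p\in[1,\infty]$; put $\hat d=d^{1/p-1/2}$, $\tilde d=1$ if $p\le 2$, and $\hat d=1$, $\tilde d=d^{1/2-1/p}$ if $p>2$. *Assumptions.* (i) The compressor $\mathcal C:\mathbb{R}^d\to\mathbb{R}^d$ is locally bounded: $\|\mathcal C(x)/r-x\|_p\le C(1-\delta)$ whenever $\|x\|_p\le C$, where $r,C>0$ and $\delta\in(0,1]$. (ii) The communication graph is undirected and connected, with symmetric nonnegative weight matrix $A$ ($A_{ij}>0$ exactly on edges) and Laplacian $L=\mathrm{diag}(\sum_jA_{ij})-A$; $\rho=\rho(L)$ is its spectral radius and $\rho_2=\rho_2(L)$ its smallest positive eigenvalue. (iii) Each $f_i$ is differentiable with $\|\nabla f_i(x)-\nabla f_i(y)\|\le\ell\|x-y\|$ for all $x,y$, $\ell>0$. (iv) $f^*=\inf f>-\infty$. (v) A number $f_{\rm low}\le f^*$ is given. *Algorithm.*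 With $v_{i,0}=\hat x_{i,-1}=y_{i,-1}=0$ and arbitrary $x_{i,0}$, for $k=0,1,\dots$ $$q_{i,k}=\mathcal C\big((x_{i,k}-\hat x_{i,k-1})/s_k\big),\quad \hat x_{i,k}=\hat x_{i,k-1}+\omega s_kq_{i,k},\quad y_{i,k}=y_{i,k-1}+\omega s_k\sum_jL_{ij}q_{j,k},$$ $$x_{i,k+1}=x_{i,k}-\alpha\big(\beta y_{i,k}+\gamma v_{i,k}+\nabla f_i(x_{i,k})\big),\qquad v_{i,k+1}=v_{i,k}+\alpha\gamma y_{i,k}.$$ Write $\bar x_k=\frac1n\sum_ix_{i,k}$. *Initial Lyapunov value.* Let $J=\frac1n\mathbf 1\mathbf 1^\top$, $E=I-J$, $F=(L+\lambda J)^{-1}$ for some $\lambda\in[\rho_2,\rho]$, and $u_i=\frac1\gamma\nabla f_i(\bar x_0)$. Put, with $\langle a,b\rangle_M=\sum_{i,j}M_{ij}\langle a_i,b_j\rangle$ and $x_0=(x_{i,0})_i$, $$\mathcal L_{1,0}=\tfrac12\langle x_0,x_0\rangle_E+\tfrac{\beta+\gamma}{2\gamma}\langle u,u\rangle_F+\langle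 x_0,u\rangle_{EF}+n\big(f(\bar x_0)-f_{\rm low}\big).$$ *Constants.* With $\beta=\tau_1\gamma$, $\kappa_1=4/\rho_2$, $\kappa_2=\max\{2+2\ell^2,\ 5/\rho_2,\ \sqrt[3]{16\ell^2(\kappa_1+1)^2/\rho_2},\ 2\sqrt2\,\ell/\rho_2\}$, $\varphi_1=\frac12(\rho_2\beta-(3\gamma+2+2\ell^2))$, $\varphi_2=3\rho^2\beta^2-\rho_2\beta\gamma+(\rho+2)\gamma^2+1+\frac52\ell^2$, $\varphi_3=\frac\gamma2-\frac5{2\rho_2}$, $\varphi_4=2\rho\gamma^2+\frac12\rho$, $\varphi_5=\frac18-\frac{(\beta+\gamma)^2\ell^2}{\gamma^5\rho_2}-\frac{\ell^2}{2\gamma^2\rho_2^2}$, $\varphi_6=\frac{(\beta+\gamma)\ell^2}{2\gamma^3\rho_2}+\frac{\ell^2}{2\gamma^2\rho_2^2}+\frac{\ell^2}{2\rho_2^2}+\frac{\ell^2}2+\frac\ell2$, $\varphi_7=(\rho+1)\gamma+\frac12\rho\beta$, $\varphi_8=3\rho^2\beta^2+(\rho-2\rho_2)\beta\gamma+(\rho+2)\gamma^2+1$,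 $\hat\kappa_0=\min\{\varphi_1/\varphi_2,\varphi_3/\varphi_4,\varphi_5/\varphi_6\}$, $\kappa_7=\min\{\hat\kappa_0,1/(2\ell)\}$, $\varepsilon_1=\frac{\tau_1\rho_2-1}{2\tau_1\rho_2}$, $\varepsilon_5=\omega r(\delta-\delta^2/2)$, $\varepsilon_8=(\varepsilon_5+2\varepsilon_5^2)/2$, $\psi_2=\varphi_7+\alpha\varphi_8$, $\psi_3=4(1+\varepsilon_5^{-1})\hat d^2\beta^2\rho^2$, $\psi_4=4(1+\varepsilon_5^{-1})\hat d^2\max\{\beta^2\rho^2+\ell^2,\gamma^2\rho\}/\varepsilon_1$, and, for a fixed $\hat\kappa_3>0$, $$\tilde\kappa_3=\max\Big\{\frac1{n^{1/2}\tilde d^2\kappa_7^2},\ \frac{(1-2\varepsilon_5)\psi_3}{\varepsilon_8}n^{1/2},\ \frac{2\psi_4\mathcal L_{1,0}}{\varepsilon_8C^2s_0^2n}\frac{n^{1/2}}{\tilde d^2},\ \frac{4(1-2\varepsilon_5)^2\psi_2^2\psi_4^2}{\varepsilon_8^2}\frac{n^{1/2}}{\tilde d^2},\ \frac{\hat\kappa_3\tilde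 d^2}{n^{1/2}}\Big\},$$ $$\tilde\kappa_4(T)=\psi_4\mathcal L_{1,0}\alpha^2/C^2+(1-2\varepsilon_5)\psi_2\psi_4n\tilde d^2s_0^2\alpha^3T.$$ *Parameters.* Take $\alpha=\frac1{n^{1/4}\tilde d\sqrt T}$, $\beta=\tau_1\gamma$, $\tau_1\ge\kappa_1$, $\gamma>\kappa_2$, $\hat\kappa_0>0$ (automatic if $\tau_1=\kappa_1$), $\omega\in(0,1/r]$, $s_0>0$ with $s_0\ge\max_i\|x_{i,0}\|_p/C$, an integer $T>\tilde\kappa_3$, and $s_k>0$ with $s_k^2=(1-\varepsilon_8)s_{k-1}^2+\tilde\kappa_4(T)$ for $k\ge1$. **Theorem.** Under these assumptions $$\frac1T\sum_{k=0}^{T-1}\Big(\|\nabla f(\bar x_k)\|^2+\frac1n\sum_{i=1}^n\|x_{i,k}-\bar x_k\|^2\Big)=\mathcal O\Big(\frac{n^{1/4}\tilde d}{\sqrt T}\Big),\qquad f(\bar x_T)-f^*=\mathcal O(1).$$ The constants hidden in $\mathcal O$ depend only on $\ell,\rho(L),\rho_2(L),\hat d,r,\delta,C,\omega,\tau_1,\gamma,s_0,\hat\kappa_3$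 and an upper bound $B$ of $\mathcal L_{1,0}/n$; in particular they are uniform in $T$, $n$, $\tilde d$, the graph, the costs, the compressor and the initial point. -/

import Mathlib

open scoped ENNReal

noncomputable section

namespace DistOpt

/-- `ℝ^d` with the Euclidean norm. -/
abbrev Vec (d : ℕ) := EuclideanSpace ℝ (Fin d)

/-- The `ℓ_p`-norm of a vector of `ℝ^d`, for `p ∈ [1, ∞]`. -/
def lpNorm {d : ℕ} (p : ℝ≥0∞) (x : Vec d) : ℝ :=
  ‖(WithLp.toLp p (fun j => x j) : PiLp p (fun _ : Fin d => ℝ))‖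

/-- `d̂`: the constant in `‖x‖_p ≤ d̂ ‖x‖`, i.e. `d^(1/p - 1/2)` for `p ≤ 2` and `1` for `p > 2`. -/
def dHat (p : ℝ≥0∞) (d : ℕ) : ℝ :=
  if p ≤ 2 then (d : ℝ) ^ ((p⁻¹).toReal - 1 / 2) else 1

/-- `d̃`: the constant in `‖x‖ ≤ d̃ ‖x‖_p`, i.e. `1` for `p ≤ 2` and `d^(1/2 - 1/p)` for `p > 2`
(with `1/∞ = 0`). -/
def dTilde (p : ℝ≥0∞) (d : ℕ) : ℝ :=
  if p ≤ 2 then 1 else (d : ℝ) ^ (1 / 2 - (p⁻¹).toReal)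

/-- A locally-bounded compressor. -/
def IsLocallyBounded {d : ℕ} (p : ℝ≥0∞) (r C δ : ℝ) (Cmp : Vec d → Vec d) : Prop :=
  ∀ x : Vec d, lpNorm p x ≤ C → lpNorm p (r⁻¹ • Cmp x - x) ≤ C * (1 - δ)

/-! ### Communication graph -/

/-- `A` is the weighted adjacency matrix of an undirected connected graph on `n` agents; the edges
are the pairs of agents with positive weight (self-loops are allowed and irrelevant). -/
structure IsUndirectedConnected {n : ℕ} (A : Matrix (Fin n) (Fin n) ℝ) : Prop where
  nonneg : ∀ i j, 0 ≤ A i j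
  symm : ∀ i j, A i j = A j i
  connected : (SimpleGraph.fromRel (fun i j => 0 < A i j)).Connected

/-- The Laplacian `L = D - A`. -/
def laplacian {n : ℕ} (A : Matrix (Fin n) (Fin n) ℝ) : Matrix (Fin n) (Fin n) ℝ :=
  Matrix.diagonal (fun i => ∑ j, A i j) - A

/-- The spectral radius `ρ(L)`. -/
def rhoMax {n : ℕ} (L : Matrix (Fin n) (Fin n) ℝ) : ℝ := (spectralRadius ℝ L).toReal

/-- The smallest positive eigenvalue `ρ₂(L)`. -/
def rhoTwo {n : ℕ} (L : Matrix (Fin n) (Fin n) ℝ) : ℝ := sInf {μ : ℝ | μ ∈ spectrum ℝ L ∧ 0 < μ}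

/-- The averaging matrix `(1/n) 1 1ᵀ`. -/
def avgMat (n : ℕ) : Matrix (Fin n) (Fin n) ℝ := Matrix.of fun _ _ => (1 : ℝ) / n

/-- `E = I - (1/n) 1 1ᵀ`. -/
def matE (n : ℕ) : Matrix (Fin n) (Fin n) ℝ := 1 - avgMat n

/-- `F`: if `L = [q Q] diag(0, Λ₁) [q Q]ᵀ` with `q = 1/√n`, then
`F = [q Q] diag(lam⁻¹, Λ₁⁻¹) [q Q]ᵀ`, which is the inverse of `L + lam • q qᵀ`. -/
def matF {n : ℕ} (L : Matrix (Fin n) (Fin n) ℝ) (lam : ℝ) : Matrix (Fin n) (Fin n) ℝ :=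
  (L + lam • avgMat n)⁻¹

/-! ### Cost functions -/

/-- `f = (1/n) ∑ f_i`. -/
def globalCost {n d : ℕ} (f : Fin n → Vec d → ℝ) (x : Vec d) : ℝ := (1 / (n : ℝ)) * ∑ i, f i x

/-- `g` is differentiable with `ℓ`-Lipschitz gradient. -/
def IsSmoothCost {d : ℕ} (ell : ℝ) (g : Vec d → ℝ) : Prop :=
  Differentiable ℝ g ∧ ∀ x y, ‖gradient g x - gradient g y‖ ≤ ell * ‖x - y‖

/-- The average `x̄` of the agents' vectors. -/
def mean {n d : ℕ} (x : Fin n → Vec d) : Vec d := (1 / (n : ℝ)) • ∑ i, x i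

/-! ### The unified compression algorithm -/

/-- At time `k`: `x = x_k`, `v = v_k`, `xhat = x̂_{k-1}`, `y = y_{k-1}`. -/
structure AlgState (n d : ℕ) where
  x : Fin n → Vec d
  v : Fin n → Vec d
  xhat : Fin n → Vec d
  y : Fin n → Vec d

/-- The transmitted vector `q_i = Cmp ((x_{i,k} - x̂_{i,k-1}) / s_k)`. -/
def compressed {n d : ℕ} (Cmp : Vec d → Vec d) (s : ℝ) (S : AlgState n d) (i : Fin n) : Vec d :=
  Cmp (s⁻¹ • (S.x i - S.xhat i))

/-- `x̂_{i,k} = x̂_{i,k-1} + ω s_k q_{i,k}`. -/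
def nextXhat {n d : ℕ} (Cmp : Vec d → Vec d) (ω s : ℝ) (S : AlgState n d) (i : Fin n) : Vec d :=
  S.xhat i + (ω * s) • compressed Cmp s S i

/-- `y_{i,k} = y_{i,k-1} + ω s_k ∑_j L_{ij} q_{j,k}`. -/
def nextY {n d : ℕ} (L : Matrix (Fin n) (Fin n) ℝ) (Cmp : Vec d → Vec d) (ω s : ℝ)
    (S : AlgState n d) (i : Fin n) : Vec d :=
  S.y i + (ω * s) • ∑ j, L i j • compressed Cmp s S j

/-- One iteration of the algorithm with scaling factor `s = s_k`. -/
def algStep {n d : ℕ} (L : Matrix (Fin n) (Fin n) ℝ) (f : Fin n → Vec d → ℝ)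
    (Cmp : Vec d → Vec d) (α β γ ω s : ℝ) (S : AlgState n d) : AlgState n d where
  x := fun i => S.x i - α • (β • nextY L Cmp ω s S i + γ • S.v i + gradient (f i) (S.x i))
  v := fun i => S.v i + (α * γ) • nextY L Cmp ω s S i
  xhat := nextXhat Cmp ω s S
  y := nextY L Cmp ω s S

/-- The run of the algorithm from `x_0`, with `v_0 = x̂_{-1} = y_{-1} = 0`. -/
def algRun {n d : ℕ} (L : Matrix (Fin n) (Fin n) ℝ) (f : Fin n → Vec d → ℝ)
    (Cmp : Vec d → Vec d) (α β γ ω : ℝ) (s : ℕ → ℝ) (x0 : Fin n → Vec d) : ℕ → AlgState n d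
  | 0 => { x := x0, v := fun _ => 0, xhat := fun _ => 0, y := fun _ => 0 }
  | k + 1 => algStep L f Cmp α β γ ω (s k) (algRun L f Cmp α β γ ω s x0 k)

/-! ### The Lyapunov function -/

/-- `xᵀ (M ⊗ I_d) y` for stacked vectors `x`, `y`. -/
def wInner {n d : ℕ} (M : Matrix (Fin n) (Fin n) ℝ) (x y : Fin n → Vec d) : ℝ :=
  ∑ i, ∑ j, M i j * inner ℝ (x i) (y j)

/-- `v + (1/γ) g⁰`, where `g⁰_i = ∇f_i(x̄)`. -/
def shiftedDual {n d : ℕ} (f : Fin n → Vec d → ℝ) (γ : ℝ) (x v : Fin n → Vec d) (i : Fin n) :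
    Vec d :=
  v i + γ⁻¹ • gradient (f i) (mean x)

/-- The Lyapunov function `e₁ + e₂ + e₃ + e₄` at primal variable `x` and dual variable `v`, where
the lower bound `flow` of the optimal value stands for the optimal value in
`e₄ = n f(x̄) - n flow`. -/
def lyapunov {n d : ℕ} (L : Matrix (Fin n) (Fin n) ℝ) (lam : ℝ) (f : Fin n → Vec d → ℝ)
    (β γ flow : ℝ) (x v : Fin n → Vec d) : ℝ :=
  1 / 2 * wInner (matE n) x x
  + 1 / 2 * ((β + γ) / γ) * wInner (matF L lam) (shiftedDual f γ x v) (shiftedDual f γ x v)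
  + wInner (matE n * matF L lam) x (shiftedDual f γ x v)
  + (n * globalCost f (mean x) - n * flow)

/-! ### Explicit constants -/

/-- The scalars on which the constants below depend: the smoothness constant `ℓ`, `ρ(L)`, `ρ₂(L)`,
`d̂`, the compressor parameters `r`, `δ`, `C`, and the algorithm parameters `ω`, `τ₁`, `γ`, `s₀`. -/
structure Params where
  ell : ℝ
  rho : ℝ
  rho2 : ℝ
  dhat : ℝ
  r : ℝ
  δ : ℝ
  C : ℝ
  ω : ℝ
  τ₁ : ℝ
  γ : ℝ
  s₀ : ℝ

namespace Params

variable (P : Params)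

def β : ℝ := P.τ₁ * P.γ

def κ₁ : ℝ := 4 / P.rho2

def κ₂ : ℝ :=
  max (max (2 + 2 * P.ell ^ 2) (5 / P.rho2))
    (max ((16 * P.ell ^ 2 * (P.κ₁ + 1) ^ 2 / P.rho2) ^ (1 / 3 : ℝ))
      (2 * √2 * P.ell / P.rho2))

def φ₁ : ℝ := 1 / 2 * (P.rho2 * P.β - (3 * P.γ + 2 + 2 * P.ell ^ 2))

def φ₂ : ℝ :=
  3 * P.rho ^ 2 * P.β ^ 2 - P.rho2 * P.β * P.γ + (P.rho + 2) * P.γ ^ 2 + 1 + 5 / 2 * P.ell ^ 2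

def φ₃ : ℝ := P.γ / 2 - 5 / 2 * P.rho2⁻¹

def φ₄ : ℝ := 2 * P.rho * P.γ ^ 2 + 1 / 2 * P.rho

def φ₅ : ℝ :=
  1 / 8 - (P.β + P.γ) ^ 2 / P.γ ^ 5 * P.rho2⁻¹ * P.ell ^ 2
    - 1 / (2 * P.γ ^ 2) * (P.rho2⁻¹) ^ 2 * P.ell ^ 2

def φ₆ : ℝ :=
  (P.β + P.γ) / (2 * P.γ ^ 3) * P.rho2⁻¹ * P.ell ^ 2
    + 1 / (2 * P.γ ^ 2) * (P.rho2⁻¹) ^ 2 * P.ell ^ 2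
    + (P.rho2⁻¹) ^ 2 / 2 * P.ell ^ 2 + P.ell ^ 2 / 2 + P.ell / 2

def φ₇ : ℝ := (P.rho + 1) * P.γ + 1 / 2 * P.rho * P.β

def φ₈ : ℝ :=
  3 * P.rho ^ 2 * P.β ^ 2 + (P.rho - 2 * P.rho2) * P.β * P.γ + (P.rho + 2) * P.γ ^ 2 + 1

def ε₁ : ℝ := (P.τ₁ * P.rho2 - 1) / (2 * P.τ₁ * P.rho2)

def ε₅ : ℝ := P.ω * P.r * (P.δ - P.δ ^ 2 / 2)

def ε₈ : ℝ := (P.ε₅ + 2 * P.ε₅ ^ 2) / 2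

def κhat₀ : ℝ := min (P.φ₁ / P.φ₂) (min (P.φ₃ / P.φ₄) (P.φ₅ / P.φ₆))

def κ₇ : ℝ := min P.κhat₀ (1 / (2 * P.ell))

def ψ₂ (α : ℝ) : ℝ := P.φ₇ + α * P.φ₈

def ψ₃ : ℝ := 4 * (1 + P.ε₅⁻¹) * P.dhat ^ 2 * P.β ^ 2 * P.rho ^ 2

def ψ₄ : ℝ :=
  4 * (1 + P.ε₅⁻¹) * P.dhat ^ 2
    * max (P.β ^ 2 * P.rho ^ 2 + P.ell ^ 2) (P.γ ^ 2 * P.rho) / P.ε₁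

end Params

/-- The stepsize `α = 1 / (n^{1/4} d̃ √T)`. -/
def stepsize (n : ℕ) (dt : ℝ) (T : ℕ) : ℝ := 1 / ((n : ℝ) ^ (1 / 4 : ℝ) * dt * √(T : ℝ))

namespace Params

variable (P : Params)

/-- The threshold `κ̃₃` for `T`; here `dt = d̃`, `L0 = 𝓛_{1,0}`, and `κhat₃ > 0` is a free constant.
It depends on `T` through the stepsize in `ψ₂`. -/
def κtilde₃ (n : ℕ) (dt κhat₃ L0 : ℝ) (T : ℕ) : ℝ :=
  max (1 / (√(n : ℝ) * dt ^ 2 * P.κ₇ ^ 2))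
    (max ((1 - 2 * P.ε₅) * P.ψ₃ / P.ε₈ * √(n : ℝ))
      (max (2 * P.ψ₄ * L0 / (P.ε₈ * P.C ^ 2 * P.s₀ ^ 2 * n) * (√(n : ℝ) / dt ^ 2))
        (max (4 * (1 - 2 * P.ε₅) ^ 2 * P.ψ₂ (stepsize n dt T) ^ 2 * P.ψ₄ ^ 2 / P.ε₈ ^ 2
            * (√(n : ℝ) / dt ^ 2))
          (κhat₃ * dt ^ 2 / √(n : ℝ)))))

/-- `κ̃₄(T) = ψ₄ 𝓛_{1,0} α² / C² + (1 - 2ε₅) ψ₂ ψ₄ n d̃² s₀² α³ T`. -/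
def κtilde₄ (n : ℕ) (dt L0 : ℝ) (T : ℕ) : ℝ :=
  P.ψ₄ * L0 * stepsize n dt T ^ 2 / P.C ^ 2
    + (1 - 2 * P.ε₅) * P.ψ₂ (stepsize n dt T) * P.ψ₄ * n * dt ^ 2 * P.s₀ ^ 2
      * stepsize n dt T ^ 3 * T

/-- `s_k²`: `s_k² = (1 - ε₈) s_{k-1}² + κ̃₄(T)`. -/
def scalingSq (n : ℕ) (dt L0 : ℝ) (T : ℕ) : ℕ → ℝ
  | 0 => P.s₀ ^ 2
  | k + 1 => (1 - P.ε₈) * scalingSq n dt L0 T k + P.κtilde₄ n dt L0 T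

/-- The scaling factor `s_k > 0`. -/
def scaling (n : ℕ) (dt L0 : ℝ) (T k : ℕ) : ℝ := √(P.scalingSq n dt L0 T k)

end Params

end DistOpt

end

open DistOpt

/-! Put w = v + γ⁻¹ (∇f_i(x̄))_i. Then the iteration reads x' = x − α(β L x̂ + γ w + e), w' = w + αγ
L x̂ + γ⁻¹ h. Here e_i = ∇f_i(x_i) − ∇f_i(x̄) is bounded by the consensus error, h is the change of
the gradients at the mean, of size O(α), and x̂ − x is the compression error. The Lyapunov function
is a quadratic form in (x, w) plus the cost gap; its cross term ⟪x, EFw⟫ produces dissipation in w.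
An exact expansion (`energy_step`) followed by Young inequalities (`energy_descent`) gives a
decrease by multiples of α‖Ex‖² and αn‖∇f(x̄)‖², up to αψ₂ times the squared compression error. Only
the operator identities and spectral bounds of `IsLaplacianTriple` enter.

The compressor is controlled only on a ball, so one must know ‖x_k − x̂_{k−1}‖_p ≤ C s_k at every
step. This depends on how far an iterate moves, hence on the Lyapunov value, hence on earlier
compression errors, hence on earlier range bounds. The joint induction in `algRun_bounds` closes
this circle. Compression contracts the squared error by 1 − 2ε₅; splitting off the move of x costs a
factor 1 + ε₅ and leaves 1 − 2ε₈; the part of the move caused by compression uses up one ε₈; the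
part caused by the Lyapunov value is at most C²κ̃₄. The sum is exactly C² s_{k+1}².

The stepsize satisfies α²√n d̃²T = 1, through which the thresholds on T become bounds on α
(`isTuned_stepsize`). They keep s_k ≤ s₀ and make the accumulated compression term O(n)
(`IsTuned.noise_le`). Dividing the summed descent by nαT gives the rate, because 1/(αT) = n^{1/4}
d̃/√T, and the surviving cost gap in the Lyapunov function bounds f(x̄_T) − f*. -/

/-! ### Operators on a real inner product space with the algebra of a graph Laplacian -/

section Abstract

variable {H : Type*} [NormedAddCommGroup H] [InnerProductSpace ℝ H]

open scoped RealInnerProductSpace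

/-- `L` behaves like the Laplacian of a connected graph with nonzero spectrum in `[ρ₂, ρ]`, `E` is the
orthogonal projection off its kernel and `F` is the inverse of `L + lam • (1 - E)`. -/
structure IsLaplacianTriple (L E F : H →ₗ[ℝ] H) (ρ₂ ρ lam : ℝ) : Prop where
  L_symm : ∀ x y, ⟪L x, y⟫ = ⟪x, L y⟫
  E_symm : ∀ x y, ⟪E x, y⟫ = ⟪x, E y⟫
  F_symm : ∀ x y, ⟪F x, y⟫ = ⟪x, F y⟫
  E_idem : ∀ x, E (E x) = E x
  E_L : ∀ x, E (L x) = L x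
  F_L : ∀ x, F (L x) = E x
  L_F : ∀ x, L (F x) = E x
  F_decomp : ∀ x, F x = E (F x) + lam⁻¹ • (x - E x)
  rho2_pos : 0 < ρ₂
  rho2_le : ρ₂ ≤ lam
  le_rho : lam ≤ ρ
  coercive : ∀ x, ρ₂ * ⟪x, E x⟫ ≤ ⟪x, L x⟫
  bounded : ∀ x, ‖L x‖ ^ 2 ≤ ρ * ⟪x, L x⟫

lemma inner_le_mul_sq_add {η : ℝ} (hη : 0 < η) (a b : H) :
    ⟪a, b⟫ ≤ η * ‖a‖ ^ 2 + (4 * η)⁻¹ * ‖b‖ ^ 2 := by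
  have h := real_inner_le_norm a b
  have h2 : 0 ≤ (4 * η)⁻¹ * (2 * η * ‖a‖ - ‖b‖) ^ 2 := by positivity
  have h3 : (4 * η)⁻¹ * (2 * η * ‖a‖ - ‖b‖) ^ 2
      = η * ‖a‖ ^ 2 + (4 * η)⁻¹ * ‖b‖ ^ 2 - ‖a‖ * ‖b‖ := by
    field_simp
    ring
  linarith

lemma neg_inner_le_mul_sq_add {η : ℝ} (hη : 0 < η) (a b : H) :
    -⟪a, b⟫ ≤ η * ‖a‖ ^ 2 + (4 * η)⁻¹ * ‖b‖ ^ 2 := by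
  have h := inner_le_mul_sq_add hη a (-b)
  rwa [inner_neg_right, norm_neg] at h

lemma norm_add_sq_le_two (a b : H) : ‖a + b‖ ^ 2 ≤ 2 * ‖a‖ ^ 2 + 2 * ‖b‖ ^ 2 := by
  have h := parallelogram_law_with_norm ℝ a b
  nlinarith [sq_nonneg ‖a - b‖]

lemma norm_sub_sq_le_two (a b : H) : ‖a - b‖ ^ 2 ≤ 2 * ‖a‖ ^ 2 + 2 * ‖b‖ ^ 2 := by
  simpa [sub_eq_add_neg] using norm_add_sq_le_two a (-b)

lemma norm_add_three_sq_le {H : Type*} [SeminormedAddCommGroup H] (a b c : H) :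
    ‖a + b + c‖ ^ 2 ≤ 3 * (‖a‖ ^ 2 + ‖b‖ ^ 2 + ‖c‖ ^ 2) := by
  have h := norm_add₃_le (a := a) (b := b) (c := c)
  have h2 : ‖a + b + c‖ ^ 2 ≤ (‖a‖ + ‖b‖ + ‖c‖) ^ 2 := by gcongr
  nlinarith [sq_nonneg (‖a‖ - ‖b‖), sq_nonneg (‖b‖ - ‖c‖), sq_nonneg (‖a‖ - ‖c‖)]

lemma norm_add_four_sq_le (a b c d : H) :
    ‖a + b + c + d‖ ^ 2 ≤ 4 * (‖a‖ ^ 2 + ‖b‖ ^ 2 + ‖c‖ ^ 2 + ‖d‖ ^ 2) := by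
  have h := norm_add_sq_le_two (a + b) (c + d)
  have h1 := norm_add_sq_le_two a b
  have h2 := norm_add_sq_le_two c d
  rw [← add_assoc] at h
  linarith

namespace IsLaplacianTriple

variable {L E F : H →ₗ[ℝ] H} {ρ₂ ρ lam : ℝ} (T : IsLaplacianTriple L E F ρ₂ ρ lam)
include T

lemma lam_pos : 0 < lam := T.rho2_pos.trans_le T.rho2_le

lemma rho_pos : 0 < ρ := T.lam_pos.trans_le T.le_rho

lemma L_E (x : H) : L (E x) = L x := by
  refine ext_inner_right ℝ fun y => ?_
  rw [T.L_symm, T.E_symm, T.E_L, T.L_symm]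

lemma E_F (x : H) : E (F x) = F (E x) := by
  rw [← T.L_F x, T.F_L]

lemma inner_E (x : H) : ⟪x, E x⟫ = ‖E x‖ ^ 2 := by
  rw [← real_inner_self_eq_norm_sq, T.E_symm, T.E_idem]

lemma norm_sq_decomp (x : H) : ‖x‖ ^ 2 = ‖E x‖ ^ 2 + ‖x - E x‖ ^ 2 := by
  have h := norm_sub_sq_real x (E x)
  rw [T.inner_E] at h
  linarith

lemma norm_E_sq_le (x : H) : ‖E x‖ ^ 2 ≤ ‖x‖ ^ 2 := by
  have := T.norm_sq_decomp x
  nlinarith [sq_nonneg ‖x - E x‖]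

lemma inner_L_nonneg (x : H) : 0 ≤ ⟪x, L x⟫ := by
  have h := T.coercive x
  rw [T.inner_E] at h
  have := T.rho2_pos
  exact le_trans (by positivity) h

/-- Cauchy–Schwarz on ⟪Ex, Lx⟫ and `bounded` give a² ≤ ρ‖Ex‖² a for a = ⟪x, Lx⟫; cancel a, treating
a = 0 apart. -/
lemma inner_L_le (x : H) : ⟪x, L x⟫ ≤ ρ * ‖E x‖ ^ 2 := by
  have h1 : ⟪x, L x⟫ = ⟪E x, L x⟫ := by rw [T.E_symm, T.E_L]
  have h2 := real_inner_le_norm (E x) (L x)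
  have h3 := T.bounded x
  have h4 := T.inner_L_nonneg x
  have h5 : ⟪x, L x⟫ ^ 2 ≤ ‖E x‖ ^ 2 * (ρ * ⟪x, L x⟫) := by
    calc ⟪x, L x⟫ ^ 2 ≤ (‖E x‖ * ‖L x‖) ^ 2 := by
          rw [← h1] at h2
          gcongr
      _ = ‖E x‖ ^ 2 * ‖L x‖ ^ 2 := by ring
      _ ≤ _ := by gcongr
  rcases h4.eq_or_lt with h | h
  · rw [← h]
    have := T.rho_pos
    positivity
  · refine le_of_mul_le_mul_right ?_ h
    linarith [h5, sq ⟪x, L x⟫]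

lemma rho2_le_rho : ρ₂ ≤ ρ := T.rho2_le.trans T.le_rho

/-- The seminorm of `F` on the range of `E`. -/
lemma inner_EF (w : H) : ⟪w, E (F w)⟫ = ⟪E (F w), L (E (F w))⟫ := by
  rw [T.L_E, T.L_F, T.E_symm, T.E_idem, real_inner_comm, T.F_symm, T.E_F, real_inner_comm]

lemma inner_EF_nonneg (w : H) : 0 ≤ ⟪w, E (F w)⟫ := by
  rw [T.inner_EF]
  exact T.inner_L_nonneg _

/-- For z = EFw one has Lz = Ew and ⟪w, z⟫ = ⟪z, Lz⟫, so bounds on F over the range of E are bounds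
on L at z: coercivity here, `bounded` in `norm_E_sq_le_inner_EF`. -/
lemma norm_EF_sq_le (w : H) : ‖E (F w)‖ ^ 2 ≤ ρ₂⁻¹ * ⟪w, E (F w)⟫ := by
  have h := T.coercive (E (F w))
  rw [← T.inner_EF, T.inner_E, T.E_idem] at h
  have h0 := T.rho2_pos
  rw [le_inv_mul_iff₀ h0]
  exact h

lemma norm_E_sq_le_inner_EF (w : H) : ‖E w‖ ^ 2 ≤ ρ * ⟪w, E (F w)⟫ := by
  have h := T.bounded (E (F w))
  rwa [← T.inner_EF, T.L_E, T.L_F] at h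

/-- F acts as lam⁻¹ on the complement of the range of E. Since lam lies in [ρ₂, ρ], the spectral
bounds on the range of E then extend to all of F. -/
lemma inner_F (w : H) : ⟪w, F w⟫ = ⟪w, E (F w)⟫ + lam⁻¹ * ‖w - E w‖ ^ 2 := by
  have h0 : ⟪w, w - E w⟫ = ‖w - E w‖ ^ 2 := by
    have := T.norm_sq_decomp w
    rw [inner_sub_right, T.inner_E, real_inner_self_eq_norm_sq]
    linarith
  conv_lhs => rw [T.F_decomp w]
  rw [inner_add_right, inner_smul_right, h0]

lemma inner_F_nonneg (w : H) : 0 ≤ ⟪w, F w⟫ := by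
  rw [T.inner_F]
  have := T.inner_EF_nonneg w
  have := T.lam_pos
  positivity

lemma inner_EF_le_inner_F (w : H) : ⟪w, E (F w)⟫ ≤ ⟪w, F w⟫ := by
  rw [T.inner_F w]
  have := T.lam_pos
  have : 0 ≤ lam⁻¹ * ‖w - E w‖ ^ 2 := by positivity
  linarith

lemma inner_EF_le (w : H) : ⟪w, E (F w)⟫ ≤ ρ₂⁻¹ * ‖E w‖ ^ 2 := by
  have h0 := T.rho2_pos
  have h1 : ⟪w, E (F w)⟫ = ⟪E w, E (F w)⟫ := by rw [T.E_symm, T.E_idem]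
  -- This weight makes the second Young term at most half of ⟪w, EFw⟫, which is absorbed on the
  -- left.
  have h2 := inner_le_mul_sq_add (η := ρ₂⁻¹ / 2) (by positivity) (E w) (E (F w))
  have h3 := T.norm_EF_sq_le w
  have h4 : (4 * (ρ₂⁻¹ / 2))⁻¹ * ‖E (F w)‖ ^ 2 ≤ 1 / 2 * ⟪w, E (F w)⟫ := by
    calc _ ≤ (4 * (ρ₂⁻¹ / 2))⁻¹ * (ρ₂⁻¹ * ⟪w, E (F w)⟫) := by gcongr
      _ = _ := by field_simp; norm_num
  rw [← h1] at h2
  linarith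

lemma inner_F_le (w : H) : ⟪w, F w⟫ ≤ ρ₂⁻¹ * ‖w‖ ^ 2 := by
  have h0 := T.rho2_pos
  rw [T.inner_F, T.norm_sq_decomp w, mul_add]
  have : lam⁻¹ ≤ ρ₂⁻¹ := by gcongr; exact T.rho2_le
  gcongr
  exact T.inner_EF_le w

lemma norm_sq_le_inner_F (w : H) : ‖w‖ ^ 2 ≤ ρ * ⟪w, F w⟫ := by
  rw [T.inner_F, T.norm_sq_decomp w, mul_add]
  have h0 := T.lam_pos
  have h1 : 1 ≤ ρ * lam⁻¹ := by
    rw [← div_eq_mul_inv, one_le_div h0]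
    exact T.le_rho
  have := T.norm_E_sq_le_inner_EF w
  nlinarith [sq_nonneg ‖w - E w‖]

lemma norm_EF_sq_le' (h : H) : ‖E (F h)‖ ^ 2 ≤ (ρ₂⁻¹) ^ 2 * ‖h‖ ^ 2 := by
  have h0 := T.rho2_pos
  calc _ ≤ ρ₂⁻¹ * ⟪h, E (F h)⟫ := T.norm_EF_sq_le h
    _ ≤ ρ₂⁻¹ * (ρ₂⁻¹ * ‖E h‖ ^ 2) := by gcongr; exact T.inner_EF_le h
    _ ≤ ρ₂⁻¹ * (ρ₂⁻¹ * ‖h‖ ^ 2) := by gcongr ρ₂⁻¹ * (ρ₂⁻¹ * ?_); exact T.norm_E_sq_le h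
    _ = _ := by ring

/-- Young's inequality for the form of F, from its nonnegativity at 2ηa − b. -/
lemma inner_F_le_mul_add {η : ℝ} (hη : 0 < η) (a b : H) :
    ⟪a, F b⟫ ≤ η * ⟪a, F a⟫ + (4 * η)⁻¹ * ⟪b, F b⟫ := by
  have h := T.inner_F_nonneg ((2 * η) • a - b)
  have hc : ⟪b, F a⟫ = ⟪a, F b⟫ := by rw [← T.F_symm, real_inner_comm]
  simp only [map_sub, map_smul, inner_sub_left, inner_sub_right, inner_smul_left,
    inner_smul_right, hc, RCLike.conj_to_real] at h
  have h3 : (4 * η)⁻¹ * (2 * η * (2 * η * ⟪a, F a⟫) - 2 * η * ⟪a, F b⟫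
      - (2 * η * ⟪a, F b⟫ - ⟪b, F b⟫)) = η * ⟪a, F a⟫ + (4 * η)⁻¹ * ⟪b, F b⟫ - ⟪a, F b⟫ := by
    field_simp
    ring
  have h4 := mul_nonneg (by positivity : 0 ≤ (4 * η)⁻¹) h
  ring_nf at h3 h4 ⊢
  linarith

end IsLaplacianTriple

end Abstract

/-! ### Energy identity and coercivity of the quadratic Lyapunov form -/

section Abstract

variable {H : Type*} [NormedAddCommGroup H] [InnerProductSpace ℝ H]

open scoped RealInnerProductSpace

namespace IsLaplacianTriple

variable {L E F : H →ₗ[ℝ] H} {ρ₂ ρ lam : ℝ} (T : IsLaplacianTriple L E F ρ₂ ρ lam)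
include T

/-- Exact change of the quadratic part of the Lyapunov function along one iteration. -/
lemma energy_step (α β γ : ℝ) (hγ : γ ≠ 0) (x xh w e h x' w' : H)
    (hx' : x' = x - α • (β • L xh + γ • w + e)) (hw' : w' = w + (α * γ) • L xh + γ⁻¹ • h) :
    1 / 2 * ⟪x', E x'⟫ + 1 / 2 * ((β + γ) / γ) * ⟪w', F w'⟫ + ⟪x', E (F w')⟫
    = 1 / 2 * ⟪x, E x⟫ + 1 / 2 * ((β + γ) / γ) * ⟪w, F w⟫ + ⟪x, E (F w)⟫
      - α * β * ⟪x, L xh⟫ - α * ⟪x, E e⟫ + α ^ 2 / 2 * ‖E (β • L xh + γ • w + e)‖ ^ 2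
      + α * γ * ⟪w, E (xh - x)⟫ + α * γ * ⟪x, E xh⟫
      + (β + γ) / γ ^ 2 * ⟪w, F h⟫ + γ⁻¹ * ⟪x, E (F h)⟫ + α * ⟪xh, E h⟫
      + α ^ 2 * γ * (γ - β) / 2 * ⟪xh, L xh⟫ + (β + γ) / (2 * γ ^ 3) * ⟪h, F h⟫
      - α * γ * ⟪w, E (F w)⟫ - α ^ 2 * γ ^ 2 * ⟪w, E xh⟫ - α * ⟪w, E (F h)⟫
      - α * ⟪e, E (F w)⟫ - α ^ 2 * γ * ⟪e, E xh⟫ - α * γ⁻¹ * ⟪e, E (F h)⟫ := by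
  set p := β • L xh + γ • w + e with hp
  have hE : ⟪x', E x'⟫ = ⟪x, E x⟫ - 2 * α * ⟪x, E p⟫ + α ^ 2 * ‖E p‖ ^ 2 := by
    have hc : ⟪p, E x⟫ = ⟪x, E p⟫ := by rw [← T.E_symm, real_inner_comm]
    rw [hx', ← T.inner_E p]
    simp only [map_sub, map_smul, inner_sub_left, inner_sub_right, inner_smul_left,
      inner_smul_right, hc, RCLike.conj_to_real]
    ring
  have hxp : ⟪x, E p⟫ = β * ⟪x, L xh⟫ + γ * ⟪x, E w⟫ + ⟪x, E e⟫ := by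
    rw [hp]
    simp only [map_add, map_smul, T.E_L, inner_add_right, inner_smul_right]
  have hwx : ⟪w, E (xh - x)⟫ = ⟪w, E xh⟫ - ⟪x, E w⟫ := by
    have h1 : ⟪w, E x⟫ = ⟪x, E w⟫ := by rw [← T.E_symm, real_inner_comm]
    rw [map_sub, inner_sub_right, h1]
  have hFw : E (F w') = E (F w) + (α * γ) • E xh + γ⁻¹ • E (F h) := by
    rw [hw']
    simp only [map_add, map_smul, T.F_L, T.E_idem]
  have hF : ⟪w', F w'⟫ = ⟪w, F w⟫ + 2 * (α * γ) * ⟪w, E xh⟫ + 2 * γ⁻¹ * ⟪w, F h⟫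
      + (α * γ) ^ 2 * ⟪xh, L xh⟫ + 2 * (α * γ) * γ⁻¹ * ⟪xh, E h⟫ + (γ⁻¹) ^ 2 * ⟪h, F h⟫ := by
    have h1 : ⟪L xh, F w⟫ = ⟪w, E xh⟫ := by rw [← T.F_symm, T.F_L, real_inner_comm]
    have h2 : ⟪h, F w⟫ = ⟪w, F h⟫ := by rw [← T.F_symm, real_inner_comm]
    have h3 : ⟪L xh, E xh⟫ = ⟪xh, L xh⟫ := by rw [← T.E_symm, T.E_L, real_inner_comm]
    have h4 : ⟪h, E xh⟫ = ⟪xh, E h⟫ := by rw [← T.E_symm, real_inner_comm]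
    have h5 : ⟪L xh, F h⟫ = ⟪xh, E h⟫ := by rw [← T.F_symm, T.F_L, T.E_symm]
    rw [hw']
    simp only [map_add, map_smul, T.F_L, inner_add_left, inner_add_right, inner_smul_left,
      inner_smul_right, h1, h2, h3, h4, h5, RCLike.conj_to_real]
    ring
  have hEF : ⟪x', E (F w')⟫ = ⟪x, E (F w)⟫ + α * γ * ⟪x, E xh⟫ + γ⁻¹ * ⟪x, E (F h)⟫
      - α * β * (⟪w, E xh⟫ + α * γ * ⟪xh, L xh⟫ + γ⁻¹ * ⟪xh, E h⟫)
      - α * γ * (⟪w, E (F w)⟫ + α * γ * ⟪w, E xh⟫ + γ⁻¹ * ⟪w, E (F h)⟫)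
      - α * (⟪e, E (F w)⟫ + α * γ * ⟪e, E xh⟫ + γ⁻¹ * ⟪e, E (F h)⟫) := by
    have h1 : ⟪L xh, E (F w)⟫ = ⟪w, E xh⟫ := by
      rw [← T.E_symm, T.E_L, ← T.F_symm, T.F_L, real_inner_comm]
    have h3 : ⟪L xh, E xh⟫ = ⟪xh, L xh⟫ := by rw [← T.E_symm, T.E_L, real_inner_comm]
    have h5 : ⟪L xh, E (F h)⟫ = ⟪xh, E h⟫ := by
      rw [← T.E_symm, T.E_L, ← T.F_symm, T.F_L, T.E_symm]
    rw [hFw, hx', hp]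
    simp only [inner_add_left, inner_add_right, inner_sub_left, inner_smul_left,
      inner_smul_right, h1, h3, h5, RCLike.conj_to_real]
    ring
  -- The dual weight (β+γ)/γ contributes α(β+γ)⟪w, E xh⟫ and the cross term removes αβ of it. The
  -- remaining αγ⟪w, E xh⟫ pairs with −αγ⟪x, Ew⟫ from the primal term, leaving αγ⟪w, E(xh − x)⟫,
  -- which vanishes without compression error.
  rw [hE, hF, hEF, hxp, hwx]
  field_simp
  ring

/-- The quadratic part of the Lyapunov function controls the consensus error and the dual error. -/
lemma energy_lower_bound {τ : ℝ} (hτ : 0 < τ) (x w : H) :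
    (τ * ρ₂ - 1) / (2 * τ * ρ₂) * ⟪x, E x⟫ + 1 / 2 * ⟪w, F w⟫
      ≤ 1 / 2 * ⟪x, E x⟫ + 1 / 2 * (τ + 1) * ⟪w, F w⟫ + ⟪x, E (F w)⟫ := by
  have h0 := T.rho2_pos
  -- The weight spends exactly τ/2 of the dual coefficient (τ+1)/2 on the cross term, keeping 1/2.
  have h1 := neg_inner_le_mul_sq_add (η := (2 * τ * ρ₂)⁻¹) (by positivity) (E x) (E (F w))
  rw [T.E_symm, T.E_idem, ← T.inner_E] at h1
  have h2 : (4 * (2 * τ * ρ₂)⁻¹)⁻¹ * ‖E (F w)‖ ^ 2 ≤ τ / 2 * ⟪w, F w⟫ := by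
    calc _ ≤ (4 * (2 * τ * ρ₂)⁻¹)⁻¹ * (ρ₂⁻¹ * ⟪w, E (F w)⟫) := by
          gcongr
          exact T.norm_EF_sq_le w
      _ = τ / 2 * ⟪w, E (F w)⟫ := by field_simp; norm_num
      _ ≤ _ := by gcongr; exact T.inner_EF_le_inner_F w
  have h3 : (τ * ρ₂ - 1) / (2 * τ * ρ₂) = 1 / 2 - (2 * τ * ρ₂)⁻¹ := by
    field_simp
  rw [h3]
  linarith

end IsLaplacianTriple

end Abstract

/-! ### One-step descent of the abstract energy -/

section Abstract

variable {H : Type*} [NormedAddCommGroup H] [InnerProductSpace ℝ H]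

open scoped RealInnerProductSpace

namespace IsLaplacianTriple

set_option maxHeartbeats 1600000 in
/-- One-step descent of the Lyapunov function. -/
theorem energy_descent {P : Params} {L E F : H →ₗ[ℝ] H} {lam : ℝ}
    (T : IsLaplacianTriple L E F P.rho2 P.rho lam) {α φ φ' : ℝ} (hα : 0 < α)
    (hγ : 0 < P.γ) (hβγ : 4 * P.γ ≤ P.rho2 * P.β) (hγρ : 5 / P.rho2 ≤ P.γ)
    {x xh w e h x' w' gb gb0 : H}
    (hx' : x' = x - α • (P.β • L xh + P.γ • w + e))
    (hw' : w' = w + (α * P.γ) • L xh + P.γ⁻¹ • h)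
    (hJw : w - E w = P.γ⁻¹ • gb0)
    (he : ‖e‖ ^ 2 ≤ P.ell ^ 2 * ⟪x, E x⟫)
    (hg : ‖gb - gb0‖ ^ 2 ≤ P.ell ^ 2 * ⟪x, E x⟫)
    (hh : ‖h‖ ^ 2 ≤ α ^ 2 * (P.ell ^ 2 * ‖gb‖ ^ 2))
    (hφ : φ' ≤ φ - α * ⟪gb, gb0⟫ + P.ell / 2 * α ^ 2 * ‖gb‖ ^ 2) :
    1 / 2 * ⟪x', E x'⟫ + 1 / 2 * ((P.β + P.γ) / P.γ) * ⟪w', F w'⟫ + ⟪x', E (F w')⟫ + φ'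
    ≤ 1 / 2 * ⟪x, E x⟫ + 1 / 2 * ((P.β + P.γ) / P.γ) * ⟪w, F w⟫ + ⟪x, E (F w)⟫ + φ
      - α * (P.φ₁ - α * P.φ₂) * ⟪x, E x⟫ - α * (P.φ₃ - α * P.φ₄) * ⟪w, E (F w)⟫
      - α * (P.φ₅ - α * P.φ₆) * ‖gb‖ ^ 2 - 3 / 40 * α * ‖gb0‖ ^ 2
      + α * P.ψ₂ α * ‖xh - x‖ ^ 2 := by
  have hρ₂ := T.rho2_pos
  have hρ := T.rho_pos
  have hρρ := T.rho2_le_rho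
  have hEw := T.norm_E_sq_le_inner_EF w
  have hEFw := T.norm_EF_sq_le w
  have hEFh := T.norm_EF_sq_le' h
  have hFh := T.inner_F_le h
  have hZ := T.inner_EF_nonneg w
  have hX := T.inner_E x
  rw [T.energy_step α P.β P.γ hγ.ne' x xh w e h x' w' hx' hw']
  simp only [Params.φ₁, Params.φ₂, Params.φ₃, Params.φ₄, Params.φ₅, Params.φ₆, Params.ψ₂,
    Params.φ₇, Params.φ₈]
  have hβ : 0 < P.β := (mul_pos_iff_of_pos_left hρ₂).1 (by linarith)
  generalize P.β = β at *
  generalize P.γ = γ at *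
  generalize P.rho2 = ρ₂ at *
  generalize P.rho = ρ at *
  generalize P.ell = ℓ at *
  have hX0 : 0 ≤ ⟪x, E x⟫ := by rw [hX]; positivity
  have hExh : ‖E xh‖ ^ 2 ≤ 2 * ⟪x, E x⟫ + 2 * ‖xh - x‖ ^ 2 := by
    have h1 : E xh = E x + E (xh - x) := by rw [map_sub]; abel
    have h2 := norm_add_sq_le_two (E x) (E (xh - x))
    have h3 := T.norm_E_sq_le (xh - x)
    rw [h1, hX]
    linarith
  -- Nonnegativity of L at xh = x + (xh − x) trades half of ⟪x, Lx⟫ for half the L-form of the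
  -- compression error.
  have b1 : -(α * β * ⟪x, L xh⟫)
      ≤ α * (-(β / 2 * ρ₂ * ⟪x, E x⟫) + β * ρ / 2 * ‖xh - x‖ ^ 2) := by
    have h1 : ⟪x, L xh⟫ = ⟪x, L x⟫ + ⟪x, L (xh - x)⟫ := by
      rw [map_sub, inner_sub_right]; ring
    have h2 : 0 ≤ ⟪x, L x⟫ + 2 * ⟪x, L (xh - x)⟫ + ⟪xh - x, L (xh - x)⟫ := by
      have h := T.inner_L_nonneg (x + (xh - x))
      have hc : ⟪xh - x, L x⟫ = ⟪x, L (xh - x)⟫ := by rw [← T.L_symm, real_inner_comm]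
      rw [map_add, inner_add_left, inner_add_right, inner_add_right, hc] at h
      linarith
    have h3 : ⟪xh - x, L (xh - x)⟫ ≤ ρ * ‖xh - x‖ ^ 2 :=
      (T.inner_L_le _).trans (mul_le_mul_of_nonneg_left (T.norm_E_sq_le _) hρ.le)
    have h4 := T.coercive x
    have h5 : -⟪x, L xh⟫ ≤ -(ρ₂ / 2 * ⟪x, E x⟫) + ρ / 2 * ‖xh - x‖ ^ 2 := by
      rw [h1]; linarith
    have h6 := mul_le_mul_of_nonneg_left h5 (by positivity : 0 ≤ α * β)
    linarith
  have b2 : -(α * ⟪x, E e⟫) ≤ α * (1 / 2 * ⟪x, E x⟫ + 1 / 2 * ℓ ^ 2 * ⟪x, E x⟫) := by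
    have h1 := neg_inner_le_mul_sq_add (η := 1 / 2) (by norm_num) (E x) e
    rw [T.E_symm, ← hX] at h1
    norm_num at h1
    have h2 : -⟪x, E e⟫ ≤ 1 / 2 * ⟪x, E x⟫ + 1 / 2 * ℓ ^ 2 * ⟪x, E x⟫ := by linarith
    have := mul_le_mul_of_nonneg_left h2 hα.le
    linarith
  have b3 : α ^ 2 / 2 * ‖E (β • L xh + γ • w + e)‖ ^ 2 ≤
      α ^ 2 * (3 / 2 * (β ^ 2 * ρ) * ⟪xh, L xh⟫ + 3 / 2 * γ ^ 2 * ρ * ⟪w, E (F w)⟫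
        + 3 / 2 * ℓ ^ 2 * ⟪x, E x⟫) := by
    have h1 := norm_add_three_sq_le (β • L xh) (γ • E w) (E e)
    have h2 : E (β • L xh + γ • w + e) = β • L xh + γ • E w + E e := by
      simp only [map_add, map_smul, T.E_L]
    rw [norm_smul, norm_smul, mul_pow, mul_pow, Real.norm_eq_abs, Real.norm_eq_abs, sq_abs,
      sq_abs] at h1
    have h3 := mul_le_mul_of_nonneg_left (T.bounded xh) (sq_nonneg β)
    have h4 := mul_le_mul_of_nonneg_left hEw (sq_nonneg γ)
    have h5 := (T.norm_E_sq_le e).trans he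
    rw [h2]
    have h6 : 1 / 2 * ‖β • L xh + γ • E w + E e‖ ^ 2 ≤ 3 / 2 * (β ^ 2 * ρ) * ⟪xh, L xh⟫
        + 3 / 2 * γ ^ 2 * ρ * ⟪w, E (F w)⟫ + 3 / 2 * ℓ ^ 2 * ⟪x, E x⟫ := by linarith
    have := mul_le_mul_of_nonneg_left h6 (sq_nonneg α)
    linarith
  have b4 : α * γ * ⟪w, E (xh - x)⟫
      ≤ α * (γ / 4 * ⟪w, E (F w)⟫ + γ * ρ * ‖xh - x‖ ^ 2) := by
    have h1 := inner_le_mul_sq_add (η := (4 * ρ)⁻¹) (by positivity) (E w) (xh - x)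
    rw [T.E_symm] at h1
    have h2 : (4 * ρ)⁻¹ * ‖E w‖ ^ 2 ≤ 1 / 4 * ⟪w, E (F w)⟫ := by
      calc _ ≤ (4 * ρ)⁻¹ * (ρ * ⟪w, E (F w)⟫) := by gcongr
        _ = _ := by field_simp
    have h3 : (4 * (4 * ρ)⁻¹)⁻¹ = ρ := by field_simp
    rw [h3] at h1
    have := mul_le_mul_of_nonneg_left (h1.trans (add_le_add_left h2 _))
      (by positivity : 0 ≤ α * γ)
    linarith
  have b5 : α * γ * ⟪x, E xh⟫
      ≤ α * (3 / 2 * γ * ⟪x, E x⟫ + 1 / 2 * γ * ‖xh - x‖ ^ 2) := by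
    have h1 := inner_le_mul_sq_add (η := 1 / 2) (by norm_num) (E x) (xh - x)
    rw [T.E_symm, ← hX, map_sub, inner_sub_right] at h1
    norm_num at h1
    have h2 : ⟪x, E xh⟫ ≤ 3 / 2 * ⟪x, E x⟫ + 1 / 2 * ‖xh - x‖ ^ 2 := by linarith
    have := mul_le_mul_of_nonneg_left h2 (by positivity : 0 ≤ α * γ)
    linarith
  have hFh' : ⟪h, F h⟫ ≤ ρ₂⁻¹ * (α ^ 2 * (ℓ ^ 2 * ‖gb‖ ^ 2)) :=
    hFh.trans (by gcongr)
  have hEFh' : ‖E (F h)‖ ^ 2 ≤ (ρ₂⁻¹) ^ 2 * (α ^ 2 * (ℓ ^ 2 * ‖gb‖ ^ 2)) :=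
    hEFh.trans (by gcongr)
  -- As h is O(α), the Young weight is proportional to α: the w half costs αγ/4, a quarter of the
  -- dual dissipation, and the h half is O(α)‖gb‖². Unlike EF, the operator F sees the mean part
  -- γ⁻¹gb0 of w, which costs α/20 of ‖gb0‖² because γρ₂ ≥ 5.
  have b6 : (β + γ) / γ ^ 2 * ⟪w, F h⟫ ≤ α * (γ / 4 * ⟪w, E (F w)⟫ + 1 / 20 * ‖gb0‖ ^ 2
      + (β + γ) ^ 2 / γ ^ 5 * ρ₂⁻¹ * ℓ ^ 2 * ‖gb‖ ^ 2) := by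
    have h1 := T.inner_F_le_mul_add (η := α * γ ^ 3 / (4 * (β + γ))) (by positivity) w h
    have h2 := mul_le_mul_of_nonneg_left h1 (by positivity : 0 ≤ (β + γ) / γ ^ 2)
    have h3 : lam⁻¹ * (γ⁻¹) ^ 2 ≤ γ⁻¹ * (1 / 5) := by
      have h4 : lam⁻¹ ≤ ρ₂⁻¹ := by gcongr; exact T.rho2_le
      have h5 : γ⁻¹ * ρ₂⁻¹ ≤ 1 / 5 := by
        rw [div_le_iff₀ hρ₂] at hγρ
        rw [← mul_inv, inv_le_comm₀ (by positivity) (by norm_num)]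
        norm_num
        exact hγρ
      calc lam⁻¹ * (γ⁻¹) ^ 2 ≤ ρ₂⁻¹ * (γ⁻¹) ^ 2 := by gcongr
        _ = γ⁻¹ * (γ⁻¹ * ρ₂⁻¹) := by ring
        _ ≤ _ := by gcongr
    have h6 : ⟪w, F w⟫ ≤ ⟪w, E (F w)⟫ + γ⁻¹ * (1 / 5) * ‖gb0‖ ^ 2 := by
      rw [T.inner_F w, hJw, norm_smul, mul_pow, Real.norm_eq_abs, sq_abs, ← mul_assoc]
      gcongr
    have h7 : (β + γ) / γ ^ 2 * (α * γ ^ 3 / (4 * (β + γ)) * ⟪w, F w⟫)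
        ≤ α * (γ / 4 * ⟪w, E (F w)⟫ + 1 / 20 * ‖gb0‖ ^ 2) := by
      calc _ ≤ (β + γ) / γ ^ 2 * (α * γ ^ 3 / (4 * (β + γ))
            * (⟪w, E (F w)⟫ + γ⁻¹ * (1 / 5) * ‖gb0‖ ^ 2)) := by gcongr
        _ = _ := by field_simp; ring
    have h8 : (β + γ) / γ ^ 2 * ((4 * (α * γ ^ 3 / (4 * (β + γ))))⁻¹ * ⟪h, F h⟫)
        ≤ α * ((β + γ) ^ 2 / γ ^ 5 * ρ₂⁻¹ * ℓ ^ 2 * ‖gb‖ ^ 2) := by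
      calc _ ≤ (β + γ) / γ ^ 2 * ((4 * (α * γ ^ 3 / (4 * (β + γ))))⁻¹
            * (ρ₂⁻¹ * (α ^ 2 * (ℓ ^ 2 * ‖gb‖ ^ 2)))) := by gcongr
        _ = _ := by field_simp
    linarith
  have b7 : γ⁻¹ * ⟪x, E (F h)⟫
      ≤ α * (1 / 2 * ⟪x, E x⟫ + 1 / (2 * γ ^ 2) * (ρ₂⁻¹) ^ 2 * ℓ ^ 2 * ‖gb‖ ^ 2) := by
    have h1 := inner_le_mul_sq_add (η := α * γ / 2) (by positivity) (E x) (E (F h))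
    rw [T.E_symm, T.E_idem, ← hX] at h1
    calc _ ≤ γ⁻¹ * (α * γ / 2 * ⟪x, E x⟫ + (4 * (α * γ / 2))⁻¹
            * ((ρ₂⁻¹) ^ 2 * (α ^ 2 * (ℓ ^ 2 * ‖gb‖ ^ 2)))) := by
          gcongr
          exact h1.trans (by gcongr)
      _ = _ := by field_simp; ring
  have b8 : α * ⟪xh, E h⟫
      ≤ α ^ 2 * (⟪x, E x⟫ + ‖xh - x‖ ^ 2 + ℓ ^ 2 / 2 * ‖gb‖ ^ 2) := by
    have h1 := inner_le_mul_sq_add (η := α / 2) (by positivity) (E xh) h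
    rw [T.E_symm] at h1
    calc _ ≤ α * (α / 2 * (2 * ⟪x, E x⟫ + 2 * ‖xh - x‖ ^ 2)
            + (4 * (α / 2))⁻¹ * (α ^ 2 * (ℓ ^ 2 * ‖gb‖ ^ 2))) := by
          gcongr
          exact h1.trans (by gcongr)
      _ = _ := by field_simp; ring
  -- The two coefficients of ⟪xh, L xh⟫ are merged before bounding, since γ(γ−β) may be negative;
  -- the sum is nonnegative because 4γ ≤ ρβ.
  have b9 : (3 / 2 * (β ^ 2 * ρ) + γ * (γ - β) / 2) * ⟪xh, L xh⟫
      ≤ (3 * ρ ^ 2 * β ^ 2 + ρ * γ * (γ - β)) * (⟪x, E x⟫ + ‖xh - x‖ ^ 2) := by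
    have h0 : 0 ≤ 3 / 2 * (β ^ 2 * ρ) + γ * (γ - β) / 2 := by
      have h1 : 4 * γ ≤ ρ * β := hβγ.trans (by gcongr)
      linarith [mul_le_mul_of_nonneg_left h1 hβ.le, sq_nonneg γ, mul_pos hβ hγ]
    calc _ ≤ (3 / 2 * (β ^ 2 * ρ) + γ * (γ - β) / 2)
          * (ρ * (2 * ⟪x, E x⟫ + 2 * ‖xh - x‖ ^ 2)) := by
          refine mul_le_mul_of_nonneg_left ((T.inner_L_le xh).trans ?_) h0
          gcongr
      _ = _ := by ring
  have b10 : (β + γ) / (2 * γ ^ 3) * ⟪h, F h⟫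
      ≤ α ^ 2 * ((β + γ) / (2 * γ ^ 3) * ρ₂⁻¹ * ℓ ^ 2 * ‖gb‖ ^ 2) := by
    calc _ ≤ (β + γ) / (2 * γ ^ 3) * (ρ₂⁻¹ * (α ^ 2 * (ℓ ^ 2 * ‖gb‖ ^ 2))) := by gcongr
      _ = _ := by ring
  have b11 : -(α ^ 2 * γ ^ 2 * ⟪w, E xh⟫)
      ≤ α ^ 2 * γ ^ 2 * (1 / 2 * ρ * ⟪w, E (F w)⟫ + ⟪x, E x⟫ + ‖xh - x‖ ^ 2) := by
    have h1 := neg_inner_le_mul_sq_add (η := 1 / 2) (by norm_num) (E w) (E xh)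
    rw [T.E_symm, T.E_idem] at h1
    norm_num at h1
    have h2 : -⟪w, E xh⟫ ≤ 1 / 2 * ρ * ⟪w, E (F w)⟫ + ⟪x, E x⟫ + ‖xh - x‖ ^ 2 := by linarith
    have := mul_le_mul_of_nonneg_left h2 (by positivity : 0 ≤ α ^ 2 * γ ^ 2)
    linarith
  have b12 : -(α * ⟪w, E (F h)⟫)
      ≤ α ^ 2 * (1 / 2 * ρ * ⟪w, E (F w)⟫ + (ρ₂⁻¹) ^ 2 / 2 * ℓ ^ 2 * ‖gb‖ ^ 2) := by
    have h1 := neg_inner_le_mul_sq_add (η := α / 2) (by positivity) (E w) (E (F h))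
    rw [T.E_symm, T.E_idem] at h1
    calc _ = α * -⟪w, E (F h)⟫ := by ring
      _ ≤ α * (α / 2 * (ρ * ⟪w, E (F w)⟫)
            + (4 * (α / 2))⁻¹ * ((ρ₂⁻¹) ^ 2 * (α ^ 2 * (ℓ ^ 2 * ‖gb‖ ^ 2)))) := by
          gcongr
          exact h1.trans (by gcongr)
      _ = _ := by field_simp; ring
  have b13 : -(α * ⟪e, E (F w)⟫)
      ≤ α * (3 / 16 * ℓ ^ 2 * ⟪x, E x⟫ + 5 / 2 * ρ₂⁻¹ * ⟪w, E (F w)⟫) := by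
    have h1 := neg_inner_le_mul_sq_add (η := 3 / 16) (by norm_num) e (E (F w))
    have h2 : 0 ≤ ρ₂⁻¹ * ⟪w, E (F w)⟫ := by positivity
    norm_num at h1
    have h3 : -⟪e, E (F w)⟫ ≤ 3 / 16 * ℓ ^ 2 * ⟪x, E x⟫ + 5 / 2 * ρ₂⁻¹ * ⟪w, E (F w)⟫ := by
      linarith
    have := mul_le_mul_of_nonneg_left h3 hα.le
    linarith
  have b14 : -(α ^ 2 * γ * ⟪e, E xh⟫)
      ≤ α ^ 2 * (1 / 2 * ℓ ^ 2 * ⟪x, E x⟫ + γ ^ 2 * (⟪x, E x⟫ + ‖xh - x‖ ^ 2)) := by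
    have h1 := neg_inner_le_mul_sq_add (η := (2 * γ)⁻¹) (by positivity) e (E xh)
    calc _ = α ^ 2 * γ * -⟪e, E xh⟫ := by ring
      _ ≤ α ^ 2 * γ * ((2 * γ)⁻¹ * (ℓ ^ 2 * ⟪x, E x⟫)
            + (4 * (2 * γ)⁻¹)⁻¹ * (2 * ⟪x, E x⟫ + 2 * ‖xh - x‖ ^ 2)) := by
          gcongr
          exact h1.trans (by gcongr)
      _ = _ := by field_simp; ring
  have b15 : -(α * γ⁻¹ * ⟪e, E (F h)⟫) ≤ α ^ 2 * (1 / 2 * ℓ ^ 2 * ⟪x, E x⟫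
      + 1 / (2 * γ ^ 2) * (ρ₂⁻¹) ^ 2 * ℓ ^ 2 * ‖gb‖ ^ 2) := by
    have h1 := neg_inner_le_mul_sq_add (η := α * γ / 2) (by positivity) e (E (F h))
    calc _ = α * γ⁻¹ * -⟪e, E (F h)⟫ := by ring
      _ ≤ α * γ⁻¹ * (α * γ / 2 * (ℓ ^ 2 * ⟪x, E x⟫)
            + (4 * (α * γ / 2))⁻¹ * ((ρ₂⁻¹) ^ 2 * (α ^ 2 * (ℓ ^ 2 * ‖gb‖ ^ 2)))) := by
          gcongr
          exact h1.trans (by gcongr)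
      _ = _ := by field_simp; ring
  -- Polarization, with only 5/16 of ‖gb − gb0‖² charged to consensus and 3/16 expanded by the
  -- parallelogram bound. Together with 1/2 from `b2` and 3/16 from `b13` this fills the single ℓ²
  -- available in φ₁. Of the 1/8 on ‖gb0‖², `b6` takes 1/20, leaving 3/40.
  have b16 : -(α * ⟪gb, gb0⟫) ≤ α * (-(1 / 8) * ‖gb‖ ^ 2 - 1 / 8 * ‖gb0‖ ^ 2
      + 5 / 16 * ℓ ^ 2 * ⟪x, E x⟫) := by
    have h1 := norm_sub_sq_real gb gb0
    have h2 := norm_sub_sq_le_two gb gb0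
    have h3 : -⟪gb, gb0⟫ ≤ -(1 / 8) * ‖gb‖ ^ 2 - 1 / 8 * ‖gb0‖ ^ 2
      + 5 / 16 * ℓ ^ 2 * ⟪x, E x⟫ := by linarith
    have := mul_le_mul_of_nonneg_left h3 hα.le
    linarith
  have b9' := mul_le_mul_of_nonneg_left b9 (sq_nonneg α)
  -- Slack between the bounds just obtained and the rounder constants φ₂, φ₈ and φ₇.
  have s1 : 0 ≤ α ^ 2 * (β * γ * (ρ - ρ₂)) * ⟪x, E x⟫ := by
    have : 0 ≤ ρ - ρ₂ := by linarith
    positivity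
  have s2 : 0 ≤ α ^ 2 * (β * γ * (ρ - ρ₂)) * ‖xh - x‖ ^ 2 := by
    have : 0 ≤ ρ - ρ₂ := by linarith
    positivity
  have s3 : 0 ≤ α * γ * ‖xh - x‖ ^ 2 := by positivity
  generalize (β + γ) ^ 2 / γ ^ 5 * ρ₂⁻¹ * ℓ ^ 2 = c₁ at *
  generalize (β + γ) / (2 * γ ^ 3) * ρ₂⁻¹ * ℓ ^ 2 = c₂ at *
  generalize 1 / (2 * γ ^ 2) * (ρ₂⁻¹) ^ 2 * ℓ ^ 2 = c₃ at *
  clear hEw hEFw hEFh hFh hEFh' hFh' hExh b9 hX hZ hX0 he hg hh hJw hx' hw'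
  linarith

end IsLaplacianTriple

end Abstract

/-! ### Spectral bounds for the Laplacian of a connected graph -/

section Spectral

open Matrix

variable {n : ℕ}

section Hermitian

variable {A : Matrix (Fin n) (Fin n) ℝ} (hA : A.IsHermitian)

/-- Coordinates of a vector in an orthonormal eigenbasis of a symmetric matrix. -/
noncomputable def eigenCoord (v : Fin n → ℝ) (i : Fin n) : ℝ :=
  (hA.eigenvectorBasis i : EuclideanSpace ℝ (Fin n)).ofLp ⬝ᵥ v

lemma eigenCoord_mulVec (v : Fin n → ℝ) (i : Fin n) :
    eigenCoord hA (A *ᵥ v) i = hA.eigenvalues i * eigenCoord hA v i := by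
  have hT : Aᵀ = A := by rw [← conjTranspose_eq_transpose_of_trivial]; exact hA
  unfold eigenCoord
  rw [dotProduct_mulVec, ← mulVec_transpose, hT, hA.mulVec_eigenvectorBasis, smul_dotProduct,
    smul_eq_mul]

lemma dotProduct_eq_sum_eigenCoord (u v : Fin n → ℝ) :
    u ⬝ᵥ v = ∑ i, eigenCoord hA u i * eigenCoord hA v i := by
  have h := hA.eigenvectorBasis.sum_inner_mul_inner (WithLp.toLp 2 u) (WithLp.toLp 2 v)
  simp only [EuclideanSpace.inner_eq_star_dotProduct, star_trivial] at h
  rw [dotProduct_comm, ← h]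
  refine Finset.sum_congr rfl fun i _ => ?_
  unfold eigenCoord
  rw [dotProduct_comm v]

lemma dotProduct_mulVec_eq_sum (v : Fin n → ℝ) :
    v ⬝ᵥ A *ᵥ v = ∑ i, hA.eigenvalues i * eigenCoord hA v i ^ 2 := by
  rw [dotProduct_eq_sum_eigenCoord hA]
  exact Finset.sum_congr rfl fun i _ => by rw [eigenCoord_mulVec]; ring

end Hermitian

variable {A : Matrix (Fin n) (Fin n) ℝ} (hA : IsUndirectedConnected A)
include hA

lemma laplacian_transpose : (laplacian A)ᵀ = laplacian A := by
  ext i j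
  by_cases h : i = j
  · subst h; simp
  · simp [laplacian, h, Ne.symm h, hA.symm j i]

lemma laplacian_isHermitian : (laplacian A).IsHermitian := by
  rw [IsHermitian, conjTranspose_eq_transpose_of_trivial, laplacian_transpose hA]

lemma laplacian_quadratic_form (v : Fin n → ℝ) :
    v ⬝ᵥ laplacian A *ᵥ v = 1 / 2 * ∑ i, ∑ j, A i j * (v i - v j) ^ 2 := by
  have h1 : v ⬝ᵥ laplacian A *ᵥ v = ∑ i, ∑ j, (A i j * v i ^ 2 - A i j * (v i * v j)) := by
    refine Finset.sum_congr rfl fun i _ => ?_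
    rw [laplacian, sub_mulVec, Pi.sub_apply, mulVec_diagonal, Finset.sum_sub_distrib, mul_sub]
    simp only [mulVec, dotProduct, Finset.mul_sum, Finset.sum_mul]
    congr 1 <;> exact Finset.sum_congr rfl fun j _ => by ring
  have h2 : ∑ i, ∑ j, A i j * v j ^ 2 = ∑ i, ∑ j, A i j * v i ^ 2 := by
    rw [Finset.sum_comm]
    exact Finset.sum_congr rfl fun i _ => Finset.sum_congr rfl fun j _ => by rw [hA.symm]
  have h3 : ∑ i, ∑ j, A i j * (v i - v j) ^ 2
      = ∑ i, ∑ j, A i j * v i ^ 2 + ∑ i, ∑ j, A i j * v j ^ 2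
        - 2 * ∑ i, ∑ j, A i j * (v i * v j) := by
    simp only [Finset.mul_sum, ← Finset.sum_add_distrib, ← Finset.sum_sub_distrib]
    exact Finset.sum_congr rfl fun i _ => Finset.sum_congr rfl fun j _ => by ring
  rw [h1, h3, h2]
  simp only [Finset.sum_sub_distrib]
  ring

lemma laplacian_quadratic_form_nonneg (v : Fin n → ℝ) : 0 ≤ v ⬝ᵥ laplacian A *ᵥ v := by
  rw [laplacian_quadratic_form hA]
  exact mul_nonneg (by norm_num)
    (Finset.sum_nonneg fun i _ => Finset.sum_nonneg fun j _ =>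
      mul_nonneg (hA.nonneg i j) (sq_nonneg _))

/-- Every term of the sum of squares vanishes, so v agrees across each edge and, by induction on a
walk, everywhere. -/
lemma const_of_laplacian_quadratic_form_eq_zero {v : Fin n → ℝ}
    (hv : v ⬝ᵥ laplacian A *ᵥ v = 0) (i j : Fin n) : v i = v j := by
  rw [laplacian_quadratic_form hA] at hv
  have h0 : ∑ i, ∑ j, A i j * (v i - v j) ^ 2 = 0 := by linarith
  have hpos : ∀ i j, 0 ≤ A i j * (v i - v j) ^ 2 := fun i j =>
    mul_nonneg (hA.nonneg i j) (sq_nonneg _)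
  have hadj : ∀ a b, 0 < A a b → v a = v b := by
    intro a b hab
    have h1 := (Finset.sum_eq_zero_iff_of_nonneg
      (fun i _ => Finset.sum_nonneg fun j _ => hpos i j)).1 h0 a (Finset.mem_univ a)
    have h2 := (Finset.sum_eq_zero_iff_of_nonneg (fun j _ => hpos a j)).1 h1 b (Finset.mem_univ b)
    rcases mul_eq_zero.1 h2 with h | h
    · exact absurd h hab.ne'
    · exact sub_eq_zero.1 (pow_eq_zero_iff (two_ne_zero) |>.1 h)
  obtain ⟨p⟩ := hA.connected.preconnected i j
  induction p with
  | nil => rfl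
  | cons h _ ih =>
    rw [SimpleGraph.fromRel_adj] at h
    rw [← ih]
    rcases h.2 with h | h
    · exact hadj _ _ h
    · exact (hadj _ _ h).symm

omit hA in
lemma avgMat_mulVec (v : Fin n → ℝ) (i : Fin n) : (avgMat n *ᵥ v) i = 1 / n * ∑ j, v j := by
  simp [avgMat, mulVec, dotProduct, Finset.mul_sum]

omit hA in
lemma matE_mulVec_of_const {v : Fin n → ℝ} (hv : ∀ i j, v i = v j) : matE n *ᵥ v = 0 := by
  ext i
  have hn : (n : ℝ) ≠ 0 := by
    have := i.pos
    positivity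
  rw [matE, sub_mulVec, one_mulVec, Pi.sub_apply, avgMat_mulVec,
    Finset.sum_congr rfl fun j _ => hv j i]
  simp [hn]

omit hA in
lemma avgMat_transpose : (avgMat n)ᵀ = avgMat n := by
  ext i j
  simp [avgMat]

omit hA in
lemma matE_transpose : (matE n)ᵀ = matE n := by
  rw [matE, transpose_sub, transpose_one, avgMat_transpose]

omit hA in
lemma avgMat_mul_self : avgMat n * avgMat n = avgMat n := by
  ext i j
  have hn : (n : ℝ) ≠ 0 := by
    have := i.pos
    positivity
  simp [avgMat, mul_apply, hn]

omit hA in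
lemma laplacian_mul_avgMat : laplacian A * avgMat n = 0 := by
  ext i j
  simp [avgMat, mul_apply, laplacian, diagonal_apply, Finset.sum_sub_distrib, ← Finset.sum_mul]

lemma avgMat_mul_laplacian : avgMat n * laplacian A = 0 := by
  have h := congrArg transpose (laplacian_mul_avgMat (A := A))
  rwa [transpose_mul, avgMat_transpose, laplacian_transpose hA, transpose_zero] at h

lemma laplacian_eigenvalues_nonneg (i : Fin n) : 0 ≤ (laplacian_isHermitian hA).eigenvalues i := by
  rw [(laplacian_isHermitian hA).eigenvalues_eq]
  simpa using laplacian_quadratic_form_nonneg hA _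

lemma laplacian_eigenvalues_le (i : Fin n) :
    (laplacian_isHermitian hA).eigenvalues i ≤ rhoMax (laplacian A) := by
  have h0 := laplacian_eigenvalues_nonneg hA i
  have hmem := (laplacian_isHermitian hA).eigenvalues_mem_spectrum_real i
  -- `toReal` sends `⊤` to 0, so finiteness is needed; it follows from the finiteness of a matrix
  -- spectrum.
  have hfin : spectralRadius ℝ (laplacian A) ≠ ⊤ := by
    have h1 := (laplacian A).finite_real_spectrum
    obtain ⟨R, hR⟩ := (h1.image fun k => ‖k‖₊).bddAbove
    refine ne_top_of_le_ne_top (ENNReal.coe_ne_top (r := R)) (iSup₂_le fun k hk => ?_)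
    exact ENNReal.coe_le_coe.2 (hR ⟨k, hk, rfl⟩)
  have h2 : (‖(laplacian_isHermitian hA).eigenvalues i‖₊ : ℝ≥0∞)
      ≤ spectralRadius ℝ (laplacian A) :=
    le_iSup₂ (f := fun k (_ : k ∈ spectrum ℝ (laplacian A)) => (‖k‖₊ : ℝ≥0∞)) _ hmem
  have h3 := ENNReal.toReal_mono hfin h2
  rw [ENNReal.coe_toReal, coe_nnnorm, Real.norm_of_nonneg h0] at h3
  exact h3

lemma rhoTwo_le_of_pos {i : Fin n} (hi : 0 < (laplacian_isHermitian hA).eigenvalues i) :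
    rhoTwo (laplacian A) ≤ (laplacian_isHermitian hA).eigenvalues i :=
  csInf_le ⟨0, fun _ h => h.2.le⟩ ⟨(laplacian_isHermitian hA).eigenvalues_mem_spectrum_real i, hi⟩

/-- The infimum of a finite nonempty set is attained. Were there no positive eigenvalue, the
quadratic form would vanish and the indicator of one vertex would be constant, impossible for two
vertices. -/
lemma rhoTwo_pos (hn : 2 ≤ n) : 0 < rhoTwo (laplacian A) := by
  have hne : {μ : ℝ | μ ∈ spectrum ℝ (laplacian A) ∧ 0 < μ}.Nonempty := by
    by_contra hcon
    rw [Set.not_nonempty_iff_eq_empty] at hcon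
    have h0 : ∀ i, (laplacian_isHermitian hA).eigenvalues i = 0 := by
      intro i
      refine le_antisymm (not_lt.1 fun h => ?_) (laplacian_eigenvalues_nonneg hA i)
      have : (laplacian_isHermitian hA).eigenvalues i ∈
          {μ : ℝ | μ ∈ spectrum ℝ (laplacian A) ∧ 0 < μ} :=
        ⟨(laplacian_isHermitian hA).eigenvalues_mem_spectrum_real i, h⟩
      rw [hcon] at this
      exact this
    have h1 := const_of_laplacian_quadratic_form_eq_zero hA
      (v := Pi.single (⟨0, by omega⟩ : Fin n) 1)
      (by rw [dotProduct_mulVec_eq_sum (laplacian_isHermitian hA)]; simp [h0])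
      ⟨0, by omega⟩ ⟨1, by omega⟩
    simp at h1
  exact (hne.csInf_mem ((laplacian A).finite_real_spectrum.subset fun _ h => h.1)).2

lemma laplacian_mulVec_sq_le (v : Fin n → ℝ) :
    (laplacian A *ᵥ v) ⬝ᵥ (laplacian A *ᵥ v)
      ≤ rhoMax (laplacian A) * (v ⬝ᵥ laplacian A *ᵥ v) := by
  rw [dotProduct_mulVec_eq_sum (laplacian_isHermitian hA),
    dotProduct_eq_sum_eigenCoord (laplacian_isHermitian hA), Finset.mul_sum]
  refine Finset.sum_le_sum fun i _ => ?_
  rw [eigenCoord_mulVec]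
  have h0 := laplacian_eigenvalues_nonneg hA i
  have h1 := laplacian_eigenvalues_le hA i
  have h2 : 0 ≤ (laplacian_isHermitian hA).eigenvalues i
    * eigenCoord (laplacian_isHermitian hA) v i ^ 2 := by positivity
  nlinarith [mul_le_mul_of_nonneg_right h1 h2]

omit hA in
lemma laplacian_mul_matE : laplacian A * matE n = laplacian A := by
  rw [matE, mul_sub, mul_one, laplacian_mul_avgMat, sub_zero]

lemma matE_mul_laplacian : matE n * laplacian A = laplacian A := by
  rw [matE, sub_mul, one_mul, avgMat_mul_laplacian hA, sub_zero]

omit hA in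
lemma matE_mul_self : matE n * matE n = matE n := by
  rw [matE, mul_sub, mul_one, sub_mul, one_mul, avgMat_mul_self, sub_self, sub_zero]

omit hA in
lemma dotProduct_mulVec_comm_of_transpose {M : Matrix (Fin n) (Fin n) ℝ} (hM : Mᵀ = M)
    (u v : Fin n → ℝ) : (M *ᵥ u) ⬝ᵥ v = u ⬝ᵥ M *ᵥ v := by
  rw [dotProduct_mulVec, ← mulVec_transpose, hM]

/-- Both forms depend only on Ev. In an eigenbasis, eigenvectors for eigenvalue 0 are constant, so
Ev has no coordinate along them; every other eigenvalue is at least ρ₂. -/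
lemma rhoTwo_mul_le_laplacian (v : Fin n → ℝ) :
    rhoTwo (laplacian A) * (v ⬝ᵥ matE n *ᵥ v) ≤ v ⬝ᵥ laplacian A *ᵥ v := by
  set hL := laplacian_isHermitian hA
  have h1 : v ⬝ᵥ matE n *ᵥ v = (matE n *ᵥ v) ⬝ᵥ (matE n *ᵥ v) := by
    rw [dotProduct_mulVec_comm_of_transpose matE_transpose, mulVec_mulVec, matE_mul_self]
  have h2 : v ⬝ᵥ laplacian A *ᵥ v = (matE n *ᵥ v) ⬝ᵥ laplacian A *ᵥ (matE n *ᵥ v) := by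
    rw [dotProduct_mulVec_comm_of_transpose matE_transpose, mulVec_mulVec, mulVec_mulVec,
      matE_mul_laplacian hA, laplacian_mul_matE]
  rw [h1, h2, dotProduct_mulVec_eq_sum hL, dotProduct_eq_sum_eigenCoord hL, Finset.mul_sum]
  refine Finset.sum_le_sum fun i _ => ?_
  rcases (laplacian_eigenvalues_nonneg hA i).eq_or_lt with h | h
  · have hc : eigenCoord hL (matE n *ᵥ v) i = 0 := by
      have hk := const_of_laplacian_quadratic_form_eq_zero hA
        (v := (hL.eigenvectorBasis i : EuclideanSpace ℝ (Fin n)).ofLp)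
        (by rw [hL.mulVec_eigenvectorBasis, ← h, zero_smul, dotProduct_zero])
      rw [eigenCoord, ← dotProduct_mulVec_comm_of_transpose matE_transpose,
        matE_mulVec_of_const hk, zero_dotProduct]
    rw [hc]; simp
  · have := rhoTwo_le_of_pos hA h
    rw [← sq]
    gcongr

end Spectral

/-! ### Stacked vectors -/

section Stacked

open Matrix
open scoped RealInnerProductSpace

variable {n d : ℕ}

/-- `(ℝ^d)^n` with the Euclidean norm. -/
abbrev Stacked (n d : ℕ) := PiLp 2 (fun _ : Fin n => Vec d)

/-- The stacked vector with blocks `x i`. -/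
abbrev stack (x : Fin n → Vec d) : Stacked n d := WithLp.toLp 2 x

/-- The action of `M ⊗ I_d` on stacked vectors. -/
noncomputable def matAct (M : Matrix (Fin n) (Fin n) ℝ) : Stacked n d →ₗ[ℝ] Stacked n d where
  toFun x := stack fun i => ∑ j, M i j • x j
  map_add' x y := by
    ext i : 1
    simp [smul_add, Finset.sum_add_distrib]
  map_smul' c x := by
    ext i : 1
    simp [Finset.smul_sum, smul_comm c]

lemma matAct_apply (M : Matrix (Fin n) (Fin n) ℝ) (x : Stacked n d) (i : Fin n) :
    matAct M x i = ∑ j, M i j • x j := rfl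

lemma matAct_mul (M N : Matrix (Fin n) (Fin n) ℝ) (x : Stacked n d) :
    matAct (M * N) x = matAct M (matAct N x) := by
  ext i : 1
  simp only [matAct_apply, mul_apply, Finset.sum_smul, Finset.smul_sum, mul_smul]
  rw [Finset.sum_comm]

lemma matAct_one (x : Stacked n d) : matAct 1 x = x := by
  ext i : 1
  simp [matAct_apply, one_apply]

lemma matAct_add (M N : Matrix (Fin n) (Fin n) ℝ) (x : Stacked n d) :
    matAct (M + N) x = matAct M x + matAct N x := by
  ext i : 1
  simp [matAct_apply, add_smul, Finset.sum_add_distrib]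

lemma matAct_sub (M N : Matrix (Fin n) (Fin n) ℝ) (x : Stacked n d) :
    matAct (M - N) x = matAct M x - matAct N x := by
  ext i : 1
  simp [matAct_apply, sub_smul, Finset.sum_sub_distrib]

lemma matAct_smul (c : ℝ) (M : Matrix (Fin n) (Fin n) ℝ) (x : Stacked n d) :
    matAct (c • M) x = c • matAct M x := by
  ext i : 1
  simp [matAct_apply, Finset.smul_sum, mul_smul]

lemma inner_matAct (M : Matrix (Fin n) (Fin n) ℝ) (x y : Fin n → Vec d) :
    ⟪stack x, matAct M (stack y)⟫ = wInner M x y := by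
  simp [PiLp.inner_apply, matAct_apply, wInner, inner_sum, inner_smul_right]

lemma matAct_inner_left (M : Matrix (Fin n) (Fin n) ℝ) (x y : Stacked n d) :
    ⟪matAct M x, y⟫ = ⟪x, matAct Mᵀ y⟫ := by
  simp only [PiLp.inner_apply, matAct_apply, inner_sum, sum_inner, inner_smul_right,
    inner_smul_left, RCLike.conj_to_real, transpose_apply]
  rw [Finset.sum_comm]

/-- The form of M ⊗ I_d splits over the d coordinates, which transfers the scalar spectral bounds to
stacked vectors. -/
lemma inner_matAct_eq_sum (M : Matrix (Fin n) (Fin n) ℝ) (x y : Stacked n d) :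
    ⟪x, matAct M y⟫ = ∑ c, (fun i => x i c) ⬝ᵥ M *ᵥ (fun i => y i c) := by
  simp only [PiLp.inner_apply, matAct_apply, inner_sum, inner_smul_right, dotProduct, mulVec,
    RCLike.inner_apply, RCLike.conj_to_real, Finset.mul_sum]
  rw [Finset.sum_comm (s := (Finset.univ : Finset (Fin d)))]
  refine Finset.sum_congr rfl fun i _ => ?_
  rw [Finset.sum_comm]
  exact Finset.sum_congr rfl fun c _ => Finset.sum_congr rfl fun j _ => by ring

lemma matAct_avgMat (x : Fin n → Vec d) : matAct (avgMat n) (stack x) = stack fun _ => mean x := by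
  ext i : 1
  simp [matAct_apply, avgMat, mean, Finset.smul_sum]

variable {A : Matrix (Fin n) (Fin n) ℝ}

/-- The form of L + lam J dominates ρ₂ times the squared norm, so the kernel is trivial. Without
this the matrix inverse defining F could be the default value 0. -/
lemma isUnit_laplacian_add (hA : IsUndirectedConnected A) (hn : 2 ≤ n) {lam : ℝ}
    (hlam : rhoTwo (laplacian A) ≤ lam) : IsUnit (laplacian A + lam • avgMat n) := by
  rw [← mulVec_injective_iff_isUnit]
  refine (injective_iff_map_eq_zero (mulVecLin (laplacian A + lam • avgMat n))).2 fun v hv => ?_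
  have hρ := rhoTwo_pos hA hn
  rw [mulVecLin_apply] at hv
  have h0 : v ⬝ᵥ laplacian A *ᵥ v + lam * (v ⬝ᵥ avgMat n *ᵥ v) = 0 := by
    rw [← dotProduct_zero v, ← hv, add_mulVec, dotProduct_add, smul_mulVec, dotProduct_smul,
      smul_eq_mul]
  have h1 := rhoTwo_mul_le_laplacian hA v
  have h2 : v ⬝ᵥ avgMat n *ᵥ v = (avgMat n *ᵥ v) ⬝ᵥ (avgMat n *ᵥ v) := by
    rw [dotProduct_mulVec_comm_of_transpose avgMat_transpose, mulVec_mulVec, avgMat_mul_self]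
  have h3 : 0 ≤ v ⬝ᵥ avgMat n *ᵥ v := by
    rw [h2]
    exact Finset.sum_nonneg fun i _ => mul_self_nonneg _
  have h4 : v ⬝ᵥ matE n *ᵥ v = v ⬝ᵥ v - v ⬝ᵥ avgMat n *ᵥ v := by
    rw [matE, sub_mulVec, one_mulVec, dotProduct_sub]
  have h5 : 0 ≤ v ⬝ᵥ v := Finset.sum_nonneg fun i _ => mul_self_nonneg _
  refine dotProduct_self_eq_zero.1 (le_antisymm ?_ h5)
  nlinarith [mul_le_mul_of_nonneg_right hlam h3]

section matF

variable (hA : IsUndirectedConnected A) (hn : 2 ≤ n) {lam : ℝ}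
  (hlam : rhoTwo (laplacian A) ≤ lam)
include hA hn hlam

lemma matF_mul : matF (laplacian A) lam * (laplacian A + lam • avgMat n) = 1 :=
  nonsing_inv_mul _ ((isUnit_iff_isUnit_det _).1 (isUnit_laplacian_add hA hn hlam))

omit hn hlam in
lemma matF_transpose : (matF (laplacian A) lam)ᵀ = matF (laplacian A) lam := by
  rw [matF, transpose_nonsing_inv, transpose_add, transpose_smul, avgMat_transpose,
    laplacian_transpose hA]

lemma matF_mul_avgMat : matF (laplacian A) lam * avgMat n = lam⁻¹ • avgMat n := by
  have hpos : lam ≠ 0 := ((rhoTwo_pos hA hn).trans_le hlam).ne'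
  have h1 : (laplacian A + lam • avgMat n) * avgMat n = lam • avgMat n := by
    rw [add_mul, laplacian_mul_avgMat, smul_mul_assoc, avgMat_mul_self, zero_add]
  have h2 := congrArg (fun M => lam⁻¹ • (matF (laplacian A) lam * M)) h1
  simp only [← mul_assoc, matF_mul hA hn hlam, one_mul, mul_smul_comm, smul_smul,
    inv_mul_cancel₀ hpos, one_smul] at h2
  exact h2.symm

lemma matF_mul_laplacian : matF (laplacian A) lam * laplacian A = matE n := by
  have hpos : lam ≠ 0 := ((rhoTwo_pos hA hn).trans_le hlam).ne'
  have h := matF_mul hA hn hlam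
  rw [mul_add, mul_smul_comm, matF_mul_avgMat hA hn hlam, smul_smul, mul_inv_cancel₀ hpos,
    one_smul] at h
  rw [matE, ← h, add_sub_cancel_right]

lemma laplacian_mul_matF : laplacian A * matF (laplacian A) lam = matE n := by
  have h := congrArg transpose (matF_mul_laplacian hA hn hlam)
  rwa [transpose_mul, matF_transpose hA, laplacian_transpose hA, matE_transpose] at h

lemma avgMat_mul_matF : avgMat n * matF (laplacian A) lam = lam⁻¹ • avgMat n := by
  have h := congrArg transpose (matF_mul_avgMat hA hn hlam)
  rwa [transpose_mul, matF_transpose hA, transpose_smul, avgMat_transpose] at h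

end matF

lemma sub_matAct_matE (x : Stacked n d) : x - matAct (matE n) x = matAct (avgMat n) x := by
  rw [matE, matAct_sub, matAct_one, sub_sub_cancel]

theorem isLaplacianTriple_matAct (d : ℕ) (hA : IsUndirectedConnected A) (hn : 2 ≤ n) {lam : ℝ}
    (hlam : lam ∈ Set.Icc (rhoTwo (laplacian A)) (rhoMax (laplacian A))) :
    IsLaplacianTriple (matAct (d := d) (laplacian A)) (matAct (matE n))
      (matAct (matF (laplacian A) lam)) (rhoTwo (laplacian A)) (rhoMax (laplacian A)) lam where
  L_symm x y := by rw [matAct_inner_left, laplacian_transpose hA]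
  E_symm x y := by rw [matAct_inner_left, matE_transpose]
  F_symm x y := by rw [matAct_inner_left, matF_transpose hA]
  E_idem x := by rw [← matAct_mul, matE_mul_self]
  E_L x := by rw [← matAct_mul, matE_mul_laplacian hA]
  F_L x := by rw [← matAct_mul, matF_mul_laplacian hA hn hlam.1]
  L_F x := by rw [← matAct_mul, laplacian_mul_matF hA hn hlam.1]
  F_decomp x := by
    rw [sub_matAct_matE, ← matAct_smul, ← avgMat_mul_matF hA hn hlam.1, ← matAct_mul,
      ← matAct_add, ← add_mul, matE, sub_add_cancel, one_mul]
  rho2_pos := rhoTwo_pos hA hn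
  rho2_le := hlam.1
  le_rho := hlam.2
  coercive x := by
    rw [inner_matAct_eq_sum, inner_matAct_eq_sum, Finset.mul_sum]
    exact Finset.sum_le_sum fun c _ => rhoTwo_mul_le_laplacian hA _
  bounded x := by
    rw [← real_inner_self_eq_norm_sq, matAct_inner_left, laplacian_transpose hA, ← matAct_mul,
      inner_matAct_eq_sum, inner_matAct_eq_sum, Finset.mul_sum]
    refine Finset.sum_le_sum fun c _ => ?_
    rw [← mulVec_mulVec, ← dotProduct_mulVec_comm_of_transpose (laplacian_transpose hA)]
    exact laplacian_mulVec_sq_le hA _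

end Stacked

/-! ### The `ℓ_p`-norm -/

section LpNorm

variable {d : ℕ}

/-- Each entry is at most the ℓ_p value S, so x_i^q ≤ x_i^p S^(q−p); sum over i. -/
lemma sum_rpow_rpow_le_of_le {ι : Type*} (s : Finset ι) (x : ι → ℝ) (hx : ∀ i, 0 ≤ x i) {p q : ℝ}
    (hp : 0 < p) (hpq : p ≤ q) :
    (∑ i ∈ s, x i ^ q) ^ (1 / q) ≤ (∑ i ∈ s, x i ^ p) ^ (1 / p) := by
  have hq : 0 < q := hp.trans_le hpq
  set S := (∑ i ∈ s, x i ^ p) ^ (1 / p) with hS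
  have hsum : 0 ≤ ∑ i ∈ s, x i ^ p := Finset.sum_nonneg fun i _ => Real.rpow_nonneg (hx i) p
  have hS0 : 0 ≤ S := Real.rpow_nonneg hsum _
  have hSp : S ^ p = ∑ i ∈ s, x i ^ p := by
    rw [hS, one_div, Real.rpow_inv_rpow hsum hp.ne']
  have hle : ∀ i ∈ s, x i ≤ S := by
    intro i hi
    rw [← Real.rpow_le_rpow_iff (hx i) hS0 hp, hSp]
    exact Finset.single_le_sum (f := fun i => x i ^ p)
      (fun j _ => Real.rpow_nonneg (hx j) p) hi
  have hfac : ∀ y : ℝ, 0 ≤ y → y ^ q = y ^ p * y ^ (q - p) := by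
    intro y hy
    rw [← Real.rpow_add_of_nonneg hy hp.le (by linarith), add_sub_cancel]
  have hmain : ∑ i ∈ s, x i ^ q ≤ S ^ q := by
    rw [hfac S hS0, hSp, Finset.sum_mul]
    refine Finset.sum_le_sum fun i hi => ?_
    rw [hfac _ (hx i)]
    exact mul_le_mul_of_nonneg_left
      (Real.rpow_le_rpow (hx i) (hle i hi) (by linarith)) (Real.rpow_nonneg (hx i) p)
  calc _ ≤ (S ^ q) ^ (1 / q) := Real.rpow_le_rpow
        (Finset.sum_nonneg fun i _ => Real.rpow_nonneg (hx i) q) hmain (by positivity)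
    _ = S := by rw [one_div, Real.rpow_rpow_inv hS0 hq.ne']

/-- The power mean inequality with exponent q/p, applied to the x_i^p. -/
lemma sum_rpow_rpow_le_card_mul {ι : Type*} (s : Finset ι) (x : ι → ℝ) (hx : ∀ i, 0 ≤ x i)
    {p q : ℝ} (hp : 0 < p) (hpq : p ≤ q) :
    (∑ i ∈ s, x i ^ p) ^ (1 / p)
      ≤ (s.card : ℝ) ^ (1 / p - 1 / q) * (∑ i ∈ s, x i ^ q) ^ (1 / q) := by
  have hq : 0 < q := hp.trans_le hpq
  have h := Real.rpow_sum_le_const_mul_sum_rpow s (fun i => x i ^ p)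
    (p := q / p) ((one_le_div hp).2 hpq)
  have hxp : ∀ i, |x i ^ p| = x i ^ p := fun i => abs_of_nonneg (Real.rpow_nonneg (hx i) p)
  have hxq : ∀ i, (x i ^ p) ^ (q / p) = x i ^ q := fun i => by
    rw [← Real.rpow_mul (hx i), mul_div_cancel₀ _ hp.ne']
  simp only [hxp, hxq] at h
  have hsum : 0 ≤ ∑ i ∈ s, x i ^ p := Finset.sum_nonneg fun i _ => Real.rpow_nonneg (hx i) p
  have hsumq : 0 ≤ ∑ i ∈ s, x i ^ q := Finset.sum_nonneg fun i _ => Real.rpow_nonneg (hx i) q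
  have h2 := Real.rpow_le_rpow (Real.rpow_nonneg hsum _) h (by positivity : 0 ≤ 1 / q)
  rw [← Real.rpow_mul hsum, Real.mul_rpow (by positivity) hsumq,
    ← Real.rpow_mul (Nat.cast_nonneg _)] at h2
  have e1 : q / p * (1 / q) = 1 / p := by field_simp
  have e2 : (q / p - 1) * (1 / q) = 1 / p - 1 / q := by field_simp
  rwa [e1, e2] at h2

lemma lpNorm_two (x : Vec d) : lpNorm 2 x = ‖x‖ := rfl

lemma lpNorm_eq_sum {p : ℝ≥0∞} (hp : 1 ≤ p) (hp' : p ≠ ⊤) (x : Vec d) :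
    lpNorm p x = (∑ i, |x i| ^ p.toReal) ^ (1 / p.toReal) := by
  have : 0 < p.toReal := ENNReal.toReal_pos (by positivity) hp'
  rw [lpNorm, PiLp.norm_eq_sum this]
  rfl

lemma lpNorm_nonneg {p : ℝ≥0∞} (hp : 1 ≤ p) (x : Vec d) : 0 ≤ lpNorm p x := by
  have : Fact (1 ≤ p) := ⟨hp⟩
  exact norm_nonneg _

lemma lpNorm_add_le {p : ℝ≥0∞} (hp : 1 ≤ p) (x y : Vec d) :
    lpNorm p (x + y) ≤ lpNorm p x + lpNorm p y := by
  have : Fact (1 ≤ p) := ⟨hp⟩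
  exact norm_add_le (WithLp.toLp p (fun j => x j) : PiLp p (fun _ : Fin d => ℝ))
    (WithLp.toLp p (fun j => y j))

lemma lpNorm_smul {p : ℝ≥0∞} (hp : 1 ≤ p) (c : ℝ) (x : Vec d) :
    lpNorm p (c • x) = |c| * lpNorm p x := by
  have : Fact (1 ≤ p) := ⟨hp⟩
  exact norm_smul c (WithLp.toLp p (fun j => x j) : PiLp p (fun _ : Fin d => ℝ))

lemma lpNorm_top_le (x : Vec d) : lpNorm ⊤ x ≤ ‖x‖ := by
  rw [lpNorm, PiLp.norm_toLp]
  refine (pi_norm_le_iff_of_nonneg (norm_nonneg _)).2 fun i => ?_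
  exact PiLp.norm_apply_le x i

lemma norm_le_lpNorm_top (x : Vec d) : ‖x‖ ≤ (d : ℝ) ^ (1 / 2 : ℝ) * lpNorm ⊤ x := by
  have h0 := lpNorm_nonneg le_top x
  have h1 : ∀ i, ‖x i‖ ≤ lpNorm ⊤ x := fun i => by
    rw [lpNorm, PiLp.norm_toLp]
    exact norm_le_pi_norm (fun j => x j) i
  rw [← Real.sqrt_eq_rpow, EuclideanSpace.norm_eq, Real.sqrt_le_iff, mul_pow,
    Real.sq_sqrt (Nat.cast_nonneg _)]
  refine ⟨by positivity, ?_⟩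
  calc ∑ i, ‖x i‖ ^ 2 ≤ ∑ _i : Fin d, lpNorm ⊤ x ^ 2 := by
        gcongr with i
        exact h1 i
    _ = _ := by simp

lemma lpNorm_le_dHat_mul {p : ℝ≥0∞} (hp : 1 ≤ p) (x : Vec d) : lpNorm p x ≤ dHat p d * ‖x‖ := by
  unfold dHat
  split_ifs with h2
  · have hp' : p ≠ ⊤ := ne_top_of_le_ne_top (by simp) h2
    have hpos : 0 < p.toReal := ENNReal.toReal_pos (by positivity) hp'
    have hle : p.toReal ≤ 2 := by simpa using ENNReal.toReal_mono (by simp) h2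
    have h := sum_rpow_rpow_le_card_mul Finset.univ (fun i => |x i|) (fun i => abs_nonneg _) hpos hle
    rw [← lpNorm_two, lpNorm_eq_sum hp hp', lpNorm_eq_sum (by norm_num) (by simp),
      ENNReal.toReal_inv, ← one_div]
    simpa using h
  · rw [one_mul]
    by_cases hp' : p = ⊤
    · subst hp'
      exact lpNorm_top_le x
    · have hle : 2 ≤ p.toReal := by simpa using ENNReal.toReal_mono hp' (not_le.1 h2).le
      have h := sum_rpow_rpow_le_of_le Finset.univ (fun i => |x i|) (fun i => abs_nonneg _)
        two_pos hle
      rw [← lpNorm_two, lpNorm_eq_sum hp hp', lpNorm_eq_sum (by norm_num) (by simp)]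
      simpa using h

lemma norm_le_dTilde_mul {p : ℝ≥0∞} (hp : 1 ≤ p) (x : Vec d) : ‖x‖ ≤ dTilde p d * lpNorm p x := by
  unfold dTilde
  split_ifs with h2
  · rw [one_mul]
    have hp' : p ≠ ⊤ := ne_top_of_le_ne_top (by simp) h2
    have hpos : 0 < p.toReal := ENNReal.toReal_pos (by positivity) hp'
    have hle : p.toReal ≤ 2 := by simpa using ENNReal.toReal_mono (by simp) h2
    have h := sum_rpow_rpow_le_of_le Finset.univ (fun i => |x i|) (fun i => abs_nonneg _) hpos hle
    rw [← lpNorm_two, lpNorm_eq_sum hp hp', lpNorm_eq_sum (by norm_num) (by simp)]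
    simpa using h
  · by_cases hp' : p = ⊤
    · subst hp'
      simpa using norm_le_lpNorm_top x
    · have hle : 2 ≤ p.toReal := by simpa using ENNReal.toReal_mono hp' (not_le.1 h2).le
      have h := sum_rpow_rpow_le_card_mul Finset.univ (fun i => |x i|) (fun i => abs_nonneg _)
        two_pos hle
      rw [← lpNorm_two, lpNorm_eq_sum hp hp', lpNorm_eq_sum (by norm_num) (by simp),
        ENNReal.toReal_inv, ← one_div p.toReal]
      simpa using h

lemma one_le_dTilde {p : ℝ≥0∞} (hd : 1 ≤ d) : 1 ≤ dTilde p d := by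
  unfold dTilde
  split_ifs with h2
  · exact le_rfl
  · refine Real.one_le_rpow (by exact_mod_cast hd) ?_
    have h3 : p⁻¹ ≤ 2⁻¹ := ENNReal.inv_le_inv.2 (not_le.1 h2).le
    have := ENNReal.toReal_mono (by simp) h3
    rw [ENNReal.toReal_inv 2] at this
    norm_num at this ⊢
    exact this

/-- One application of a locally bounded compressor shrinks the quantization error. -/
lemma compression_error {p : ℝ≥0∞} (hp : 1 ≤ p) {r C δ ω s : ℝ} (hr : 0 < r) (hC : 0 < C) (hω : 0 < ω)
    (hωr : ω ≤ 1 / r) (hs : 0 < s) {Cmp : Vec d → Vec d}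
    (hCmp : IsLocallyBounded p r C δ Cmp) {z : Vec d} (hz : lpNorm p z ≤ C * s) :
    lpNorm p (z - (ω * s) • Cmp (s⁻¹ • z)) ^ 2
      ≤ (1 - 2 * (ω * r * (δ - δ ^ 2 / 2))) * (C * s) ^ 2 := by
  have h1 : lpNorm p (s⁻¹ • z) ≤ C := by
    rw [lpNorm_smul hp, abs_of_pos (inv_pos.2 hs), inv_mul_le_iff₀ hs, mul_comm s]
    exact hz
  have h2 := hCmp _ h1
  have hωr' : ω * r ≤ 1 := by rwa [le_div_iff₀ hr] at hωr
  -- Since ωr ≤ 1, this is a convex combination of z and the residual of a full step, whose bounds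
  -- Cs and Cs(1−δ) give Cs(1−ωrδ).
  have h3 : z - (ω * s) • Cmp (s⁻¹ • z)
      = (1 - ω * r) • z + (-(ω * r * s)) • (r⁻¹ • Cmp (s⁻¹ • z) - s⁻¹ • z) := by
    rw [smul_sub, smul_smul, smul_smul]
    have e1 : -(ω * r * s) * r⁻¹ = -(ω * s) := by field_simp
    have e2 : -(ω * r * s) * s⁻¹ = -(ω * r) := by field_simp
    rw [e1, e2]
    module
  have h4 : lpNorm p (z - (ω * s) • Cmp (s⁻¹ • z))
      ≤ (1 - ω * r) * (C * s) + ω * r * s * (C * (1 - δ)) := by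
    rw [h3]
    refine (lpNorm_add_le hp _ _).trans ?_
    rw [lpNorm_smul hp, lpNorm_smul hp, abs_neg, abs_of_nonneg (by linarith : 0 ≤ 1 - ω * r),
      abs_of_pos (by positivity)]
    have : 0 ≤ 1 - ω * r := by linarith
    gcongr
  have h5 := lpNorm_nonneg hp (z - (ω * s) • Cmp (s⁻¹ • z))
  calc _ ≤ ((1 - ω * r) * (C * s) + ω * r * s * (C * (1 - δ))) ^ 2 := by gcongr
    _ = (C * s) ^ 2 * (1 - ω * r * δ) ^ 2 := by ring
    _ ≤ (C * s) ^ 2 * (1 - 2 * (ω * r * (δ - δ ^ 2 / 2))) := by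
        gcongr
        nlinarith [mul_nonneg (mul_nonneg (mul_pos hω hr).le (sub_nonneg.2 hωr')) (sq_nonneg δ)]
    _ = _ := by ring

end LpNorm

/-! ### Smooth costs -/

section Smooth

open scoped RealInnerProductSpace

variable {d : ℕ} {ell : ℝ} {g : Vec d → ℝ}

lemma DistOpt.IsSmoothCost.hasDerivAt_line (hg : IsSmoothCost ell g) (x v : Vec d) (t : ℝ) :
    HasDerivAt (fun t : ℝ => g (x + t • v)) ⟪gradient g (x + t • v), v⟫ t := by
  have h1 := (hg.1 (x + t • v)).hasGradientAt.hasFDerivAt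
  have h2 : HasDerivAt (fun t : ℝ => x + t • v) v t := by
    simpa using ((hasDerivAt_id t).smul_const v).const_add x
  exact h1.comp_hasDerivAt t h2

/-- The descent lemma. -/
lemma DistOpt.IsSmoothCost.le_quadratic (hg : IsSmoothCost ell g) (x v : Vec d) :
    g (x + v) ≤ g x + ⟪gradient g x, v⟫ + ell / 2 * ‖v‖ ^ 2 := by
  -- The claim is φ 1 ≤ φ 0; the Lipschitz gradient makes the derivative of φ nonpositive on (0, 1).
  set φ : ℝ → ℝ := fun t => g (x + t • v) - t * ⟪gradient g x, v⟫ - ell / 2 * t ^ 2 * ‖v‖ ^ 2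
  have hφ : ∀ t, HasDerivAt φ
      (⟪gradient g (x + t • v), v⟫ - ⟪gradient g x, v⟫ - ell * t * ‖v‖ ^ 2) t := by
    intro t
    have h1 := hg.hasDerivAt_line x v t
    have h2 : HasDerivAt (fun t : ℝ => t * ⟪gradient g x, v⟫) ⟪gradient g x, v⟫ t := by
      simpa using (hasDerivAt_id t).mul_const ⟪gradient g x, v⟫
    have h3 : HasDerivAt (fun t : ℝ => ell / 2 * t ^ 2 * ‖v‖ ^ 2) (ell * t * ‖v‖ ^ 2) t := by
      have h4 := ((hasDerivAt_pow 2 t).const_mul (ell / 2)).mul_const (‖v‖ ^ 2)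
      have e : ell / 2 * (((2 : ℕ) : ℝ) * t ^ (2 - 1)) * ‖v‖ ^ 2 = ell * t * ‖v‖ ^ 2 := by
        push_cast
        ring
      rwa [e] at h4
    exact (h1.sub h2).sub h3
  have hanti : AntitoneOn φ (Set.Icc 0 1) := by
    refine antitoneOn_of_deriv_nonpos (convex_Icc 0 1)
      (fun t _ => (hφ t).continuousAt.continuousWithinAt)
      (fun t _ => (hφ t).differentiableAt.differentiableWithinAt) fun t ht => ?_
    rw [interior_Icc] at ht
    rw [(hφ t).deriv, ← inner_sub_left]
    have h1 := real_inner_le_norm (gradient g (x + t • v) - gradient g x) v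
    have h2 := hg.2 (x + t • v) x
    rw [add_sub_cancel_left, norm_smul, Real.norm_eq_abs, abs_of_pos ht.1] at h2
    have h3 := mul_le_mul_of_nonneg_right h2 (norm_nonneg v)
    nlinarith
  have h := hanti (Set.left_mem_Icc.2 zero_le_one) (Set.right_mem_Icc.2 zero_le_one) zero_le_one
  simp only [φ, one_smul, zero_smul, add_zero] at h
  linarith

/-- A gradient step of length ℓ⁻¹ lowers g by at least ‖∇g‖²/(2ℓ) and cannot go below m. This turns
a bound on the cost gap into a bound on each single gradient. -/
lemma DistOpt.IsSmoothCost.norm_gradient_sq_le (hg : IsSmoothCost ell g) (hell : 0 < ell) {m : ℝ}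
    (hm : ∀ x, m ≤ g x) (x : Vec d) : ‖gradient g x‖ ^ 2 ≤ 2 * ell * (g x - m) := by
  have h := hg.le_quadratic x (-(ell⁻¹ • gradient g x))
  have h2 := hm (x + -(ell⁻¹ • gradient g x))
  rw [inner_neg_right, inner_smul_right, norm_neg, norm_smul, real_inner_self_eq_norm_sq, mul_pow,
    Real.norm_eq_abs, sq_abs] at h
  have e : ell / 2 * ((ell⁻¹) ^ 2 * ‖gradient g x‖ ^ 2) = ell⁻¹ * ‖gradient g x‖ ^ 2 / 2 := by
    field_simp
  have h3 : ell⁻¹ * ‖gradient g x‖ ^ 2 ≤ 2 * (g x - m) := by linarith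
  rw [inv_mul_le_iff₀ hell] at h3
  linarith

variable {n : ℕ} {f : Fin n → Vec d → ℝ}

lemma hasGradientAt_globalCost (hf : ∀ i, Differentiable ℝ (f i)) (x : Vec d) :
    HasGradientAt (globalCost f) (mean fun i => gradient (f i) x) x := by
  rw [hasGradientAt_iff_hasFDerivAt]
  have h := (HasFDerivAt.fun_sum (u := Finset.univ) fun i _ =>
    ((hf i) x).hasGradientAt.hasFDerivAt).const_mul (1 / (n : ℝ))
  have e : InnerProductSpace.toDual ℝ (Vec d) (mean fun i => gradient (f i) x)
      = (1 / (n : ℝ)) • ∑ i, InnerProductSpace.toDual ℝ (Vec d) (gradient (f i) x) := by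
    simp [mean]
  rw [e]
  exact h

lemma gradient_globalCost (hf : ∀ i, IsSmoothCost ell (f i)) (x : Vec d) :
    gradient (globalCost f) x = mean fun i => gradient (f i) x :=
  (hasGradientAt_globalCost (fun i => (hf i).1) x).gradient

lemma isSmoothCost_globalCost (hn : 0 < n) (hf : ∀ i, IsSmoothCost ell (f i)) :
    IsSmoothCost ell (globalCost f) := by
  refine ⟨fun x => (hasGradientAt_globalCost (fun i => (hf i).1) x).differentiableAt,
    fun x y => ?_⟩
  rw [gradient_globalCost hf, gradient_globalCost hf, mean, mean, ← smul_sub,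
    ← Finset.sum_sub_distrib, norm_smul, Real.norm_of_nonneg (by positivity)]
  calc _ ≤ 1 / (n : ℝ) * ∑ _i : Fin n, ell * ‖x - y‖ := by
        gcongr
        exact norm_sum_le_of_le _ fun i _ => (hf i).2 x y
    _ = _ := by
        simp only [Finset.sum_const, Finset.card_univ, Fintype.card_fin, nsmul_eq_mul]
        field_simp

end Smooth

/-! ### Signs of the explicit constants -/

namespace DistOpt.Params

/-- The standing assumptions on the scalar parameters. -/
structure Admissible (P : Params) : Prop where
  ell_pos : 0 < P.ell
  r_pos : 0 < P.r
  C_pos : 0 < P.C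
  δ_pos : 0 < P.δ
  δ_le : P.δ ≤ 1
  ω_pos : 0 < P.ω
  ω_le : P.ω ≤ 1 / P.r
  s₀_pos : 0 < P.s₀
  κ₁_le : P.κ₁ ≤ P.τ₁
  κ₂_lt : P.κ₂ < P.γ
  κhat₀_pos : 0 < P.κhat₀
  rho2_pos : 0 < P.rho2
  rho2_le : P.rho2 ≤ P.rho

namespace Admissible

variable {P : Params} (h : P.Admissible)
include h

lemma rho_pos : 0 < P.rho := h.rho2_pos.trans_le h.rho2_le

lemma five_div_le : 5 / P.rho2 ≤ P.γ :=
  ((le_max_right _ _).trans (le_max_left _ _)).trans h.κ₂_lt.le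

lemma γ_pos : 0 < P.γ := (div_pos (by norm_num) h.rho2_pos).trans_le h.five_div_le

lemma four_le : 4 ≤ P.τ₁ * P.rho2 := (div_le_iff₀ h.rho2_pos).1 h.κ₁_le

lemma τ₁_pos : 0 < P.τ₁ := (div_pos (by norm_num) h.rho2_pos).trans_le h.κ₁_le

lemma β_pos : 0 < P.β := mul_pos h.τ₁_pos h.γ_pos

lemma four_mul_γ_le : 4 * P.γ ≤ P.rho2 * P.β := by
  have := mul_le_mul_of_nonneg_right h.four_le h.γ_pos.le
  rw [β]
  linarith

/-- Lets the term 3ρ²β² absorb the negative ρ₂βγ terms in φ₂ and φ₈. -/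
lemma rho2_mul_le : P.rho2 * P.β * P.γ ≤ P.rho ^ 2 * P.β ^ 2 := by
  have h1 := h.four_mul_γ_le
  have h2 : P.rho2 * P.β ≤ P.rho * P.β := mul_le_mul_of_nonneg_right h.rho2_le h.β_pos.le
  have h3 : P.γ ≤ P.rho * P.β := by linarith [h.γ_pos]
  calc _ ≤ P.rho * P.β * (P.rho * P.β) :=
        mul_le_mul h2 h3 h.γ_pos.le (mul_pos h.rho_pos h.β_pos).le
    _ = _ := by ring

lemma φ₂_pos : 0 < P.φ₂ := by
  have h1 := h.rho2_mul_le
  have h2 := h.rho_pos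
  have h3 : 0 ≤ P.rho ^ 2 * P.β ^ 2 := by positivity
  have h4 : 0 ≤ (P.rho + 2) * P.γ ^ 2 := by positivity
  rw [φ₂]
  nlinarith [sq_nonneg P.ell]

lemma φ₄_pos : 0 < P.φ₄ := by
  have := h.rho_pos
  rw [φ₄]
  positivity

lemma φ₆_pos : 0 < P.φ₆ := by
  have := h.rho2_pos
  have := h.ell_pos
  have := h.γ_pos
  have := h.β_pos
  rw [φ₆]
  positivity

lemma φ₇_nonneg : 0 ≤ P.φ₇ := by
  have := h.rho_pos
  have := h.γ_pos
  have := h.β_pos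
  rw [φ₇]
  positivity

lemma φ₈_nonneg : 0 ≤ P.φ₈ := by
  have h1 := h.rho2_mul_le
  have h2 := h.rho_pos
  have h3 : 0 ≤ P.rho ^ 2 * P.β ^ 2 := by positivity
  have h4 : 0 ≤ (P.rho + 2) * P.γ ^ 2 := by positivity
  have h5 : 0 ≤ P.rho * P.β * P.γ := mul_nonneg (mul_pos h2 h.β_pos).le h.γ_pos.le
  rw [φ₈]
  nlinarith

lemma φ₁_sub_nonneg {α : ℝ} (hα : α ≤ P.κhat₀) : 0 ≤ P.φ₁ - α * P.φ₂ := by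
  have h1 := (le_div_iff₀ h.φ₂_pos).1 (hα.trans (min_le_left _ _))
  linarith

lemma φ₃_sub_nonneg {α : ℝ} (hα : α ≤ P.κhat₀) : 0 ≤ P.φ₃ - α * P.φ₄ := by
  have h1 := (le_div_iff₀ h.φ₄_pos).1 (hα.trans ((min_le_right _ _).trans (min_le_left _ _)))
  linarith

lemma φ₅_sub_nonneg {α : ℝ} (hα : α ≤ P.κhat₀) : 0 ≤ P.φ₅ - α * P.φ₆ := by
  have h1 := (le_div_iff₀ h.φ₆_pos).1 (hα.trans ((min_le_right _ _).trans (min_le_right _ _)))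
  linarith

lemma φ₁_pos : 0 < P.φ₁ := by
  have h1 := h.φ₁_sub_nonneg le_rfl
  have := mul_pos h.κhat₀_pos h.φ₂_pos
  linarith

lemma ψ₂_nonneg {α : ℝ} (hα : 0 ≤ α) : 0 ≤ P.ψ₂ α :=
  add_nonneg h.φ₇_nonneg (mul_nonneg hα h.φ₈_nonneg)

lemma ψ₂_mono {α α' : ℝ} (hα : α ≤ α') : P.ψ₂ α ≤ P.ψ₂ α' :=
  add_le_add_right (mul_le_mul_of_nonneg_right hα h.φ₈_nonneg) _

lemma ε₁_pos : 0 < P.ε₁ := by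
  have := h.four_le
  have := h.rho2_pos
  have := h.τ₁_pos
  exact div_pos (by linarith) (by positivity)

lemma ε₁_le : P.ε₁ ≤ 1 / 2 := by
  have := h.rho2_pos
  have := h.τ₁_pos
  rw [ε₁, div_le_div_iff₀ (by positivity) (by norm_num)]
  linarith

lemma ω_mul_r_le : P.ω * P.r ≤ 1 := (le_div_iff₀ h.r_pos).1 h.ω_le

lemma ε₅_pos : 0 < P.ε₅ := by
  have h1 := h.δ_pos
  have h2 := h.δ_le
  have h3 : 0 < P.δ - P.δ ^ 2 / 2 := by nlinarith
  exact mul_pos (mul_pos h.ω_pos h.r_pos) h3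

lemma ε₅_le : P.ε₅ ≤ 1 / 2 := by
  have h3 : P.δ - P.δ ^ 2 / 2 ≤ 1 / 2 := by nlinarith [sq_nonneg (P.δ - 1)]
  calc P.ε₅ ≤ P.ω * P.r * (1 / 2) :=
        mul_le_mul_of_nonneg_left h3 (mul_pos h.ω_pos h.r_pos).le
    _ ≤ 1 / 2 := by linarith [h.ω_mul_r_le]

lemma one_sub_two_ε₅_nonneg : 0 ≤ 1 - 2 * P.ε₅ := by linarith [h.ε₅_le]

lemma ε₈_pos : 0 < P.ε₈ := by
  have := h.ε₅_pos
  rw [ε₈]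
  positivity

lemma ε₈_le : P.ε₈ ≤ 1 / 2 := by
  have := h.ε₅_pos
  have := h.ε₅_le
  rw [ε₈]
  nlinarith

lemma ψ₃_nonneg : 0 ≤ P.ψ₃ := by
  have := h.ε₅_pos
  rw [ψ₃]
  positivity

lemma ψ₄_nonneg : 0 ≤ P.ψ₄ := by
  have := h.ε₅_pos
  have := h.ε₁_pos
  rw [ψ₄]
  have : 0 ≤ max (P.β ^ 2 * P.rho ^ 2 + P.ell ^ 2) (P.γ ^ 2 * P.rho) :=
    le_max_of_le_left (by positivity)
  positivity

end Admissible

end DistOpt.Params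

/-! ### One iteration of the algorithm -/

section Step

open Matrix
open scoped RealInnerProductSpace

variable {n d : ℕ}

lemma norm_stack_sq (x : Fin n → Vec d) : ‖stack x‖ ^ 2 = ∑ i, ‖x i‖ ^ 2 :=
  PiLp.norm_sq_eq_of_L2 _ _

lemma matAct_matE (x : Fin n → Vec d) :
    matAct (matE n) (stack x) = stack fun i => x i - mean x := by
  rw [matE, matAct_sub, matAct_one, matAct_avgMat]
  rfl

lemma norm_stack_const_sq (a : Vec d) : ‖stack (fun _ : Fin n => a)‖ ^ 2 = n * ‖a‖ ^ 2 := by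
  rw [norm_stack_sq]
  simp

lemma mean_add (x y : Fin n → Vec d) : mean (fun i => x i + y i) = mean x + mean y := by
  simp [mean, Finset.sum_add_distrib]

lemma mean_smul (c : ℝ) (x : Fin n → Vec d) : mean (fun i => c • x i) = c • mean x := by
  rw [mean, mean, ← Finset.smul_sum, smul_comm]

lemma mean_sub (x y : Fin n → Vec d) : mean (fun i => x i - y i) = mean x - mean y := by
  simp [mean, Finset.sum_sub_distrib, smul_sub]

/-- The standing assumptions on the network and on the costs. -/
structure IsNetwork (P : Params) (A : Matrix (Fin n) (Fin n) ℝ) (f : Fin n → Vec d → ℝ)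
    (lam : ℝ) : Prop where
  two_le : 2 ≤ n
  connected : IsUndirectedConnected A
  rho_eq : rhoMax (laplacian A) = P.rho
  rho2_eq : rhoTwo (laplacian A) = P.rho2
  lam_mem : lam ∈ Set.Icc P.rho2 P.rho
  smooth : ∀ i, IsSmoothCost P.ell (f i)

/-- The invariants `y_{k-1} = L x̂_{k-1}` and `∑ v_{i,k} = 0` of the algorithm. -/
structure IsConsistent (A : Matrix (Fin n) (Fin n) ℝ) (S : AlgState n d) : Prop where
  y_eq : stack S.y = matAct (laplacian A) (stack S.xhat)
  mean_v : mean S.v = 0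

variable {P : Params} {A : Matrix (Fin n) (Fin n) ℝ} {f : Fin n → Vec d → ℝ} {lam : ℝ}
  {Cmp : Vec d → Vec d} {S : AlgState n d} {α s : ℝ}

lemma IsNetwork.triple (hN : IsNetwork P A f lam) :
    IsLaplacianTriple (matAct (d := d) (laplacian A)) (matAct (matE n))
      (matAct (matF (laplacian A) lam)) P.rho2 P.rho lam := by
  have h := isLaplacianTriple_matAct d hN.connected hN.two_le (lam := lam)
    (by rw [hN.rho_eq, hN.rho2_eq]; exact hN.lam_mem)
  rwa [hN.rho_eq, hN.rho2_eq] at h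

lemma IsConsistent.nextY_eq (hS : IsConsistent A S) (ω s : ℝ) :
    stack (nextY (laplacian A) Cmp ω s S)
      = matAct (laplacian A) (stack (nextXhat Cmp ω s S)) := by
  have h1 : stack (nextXhat Cmp ω s S) = stack S.xhat + (ω * s) • stack (compressed Cmp s S) := rfl
  rw [h1, map_add, map_smul, ← hS.y_eq]
  rfl

lemma mean_eq_zero_of_matAct_laplacian (hA : IsUndirectedConnected A) {y x : Fin n → Vec d}
    (h : stack y = matAct (laplacian A) (stack x)) (hn : 0 < n) : mean y = 0 := by
  have h1 := matAct_avgMat y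
  rw [h, ← matAct_mul, avgMat_mul_laplacian hA] at h1
  have h2 := congrArg (fun z : Stacked n d => z ⟨0, hn⟩) h1
  simpa [matAct_apply] using h2.symm

section algStep

variable (hN : IsNetwork P A f lam) (hS : IsConsistent A S)
include hN hS

lemma IsConsistent.mean_nextY (ω s : ℝ) : mean (nextY (laplacian A) Cmp ω s S) = 0 :=
  mean_eq_zero_of_matAct_laplacian hN.connected (hS.nextY_eq ω s) (by linarith [hN.two_le])

lemma IsConsistent.algStep (α β γ ω s : ℝ) :
    IsConsistent A (algStep (laplacian A) f Cmp α β γ ω s S) where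
  y_eq := hS.nextY_eq ω s
  mean_v := by
    have h : (DistOpt.algStep (laplacian A) f Cmp α β γ ω s S).v
      = fun i => S.v i + (α * γ) • nextY (laplacian A) Cmp ω s S i := rfl
    rw [h, mean_add, mean_smul, hS.mean_v, hS.mean_nextY hN, smul_zero, add_zero]

/-- Both y and v average to zero, so the mean makes a plain step along the averaged gradients and
compression error never enters it directly. -/
lemma IsConsistent.mean_algStep_x (α β γ ω s : ℝ) :
    mean (DistOpt.algStep (laplacian A) f Cmp α β γ ω s S).x
      = mean S.x - α • mean (fun i => gradient (f i) (S.x i)) := by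
  have h : (DistOpt.algStep (laplacian A) f Cmp α β γ ω s S).x
      = fun i => S.x i - α • (β • nextY (laplacian A) Cmp ω s S i + γ • S.v i
        + gradient (f i) (S.x i)) := rfl
  rw [h, mean_sub, mean_smul, mean_add, mean_add, mean_smul, mean_smul, hS.mean_v,
    hS.mean_nextY hN, smul_zero, smul_zero, add_zero, zero_add]

lemma IsConsistent.mean_shiftedDual (γ : ℝ) :
    mean (shiftedDual f γ S.x S.v) = γ⁻¹ • gradient (globalCost f) (mean S.x) := by
  have h : shiftedDual f γ S.x S.v = fun i => S.v i + γ⁻¹ • gradient (f i) (mean S.x) := rfl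
  rw [h, mean_add, mean_smul, hS.mean_v, zero_add, gradient_globalCost hN.smooth]

end algStep

lemma lyapunov_eq (L : Matrix (Fin n) (Fin n) ℝ) (lam : ℝ) (f : Fin n → Vec d → ℝ)
    (β γ flow : ℝ) (x v : Fin n → Vec d) :
    lyapunov L lam f β γ flow x v =
      1 / 2 * ⟪stack x, matAct (matE n) (stack x)⟫
      + 1 / 2 * ((β + γ) / γ) * ⟪stack (shiftedDual f γ x v),
          matAct (matF L lam) (stack (shiftedDual f γ x v))⟫
      + ⟪stack x, matAct (matE n) (matAct (matF L lam) (stack (shiftedDual f γ x v)))⟫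
      + (n * globalCost f (mean x) - n * flow) := by
  rw [lyapunov, ← matAct_mul, inner_matAct, inner_matAct, inner_matAct]

lemma inner_matE_stack (x : Fin n → Vec d) :
    ⟪stack x, matAct (matE n) (stack x)⟫ = ∑ i, ‖x i - mean x‖ ^ 2 := by
  have h : matAct (matE n) (stack x) = matAct (matE n) (matAct (matE n) (stack x)) := by
    rw [← matAct_mul, matE_mul_self]
  rw [h, ← matE_transpose, ← matAct_inner_left, matE_transpose, real_inner_self_eq_norm_sq,
    matAct_matE, norm_stack_sq]

/-- The gradient deviation `∇f_i(x_i) - ∇f_i(x̄)`. -/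
noncomputable def gradDeviation (f : Fin n → Vec d → ℝ) (x : Fin n → Vec d) (i : Fin n) : Vec d :=
  gradient (f i) (x i) - gradient (f i) (mean x)

lemma norm_gradDeviation_sq_le (hf : ∀ i, IsSmoothCost P.ell (f i)) (x : Fin n → Vec d) :
    ‖stack (gradDeviation f x)‖ ^ 2
      ≤ P.ell ^ 2 * ⟪stack x, matAct (matE n) (stack x)⟫ := by
  rw [inner_matE_stack, norm_stack_sq, Finset.mul_sum]
  refine Finset.sum_le_sum fun i _ => ?_
  rw [← mul_pow]
  exact pow_le_pow_left₀ (norm_nonneg _) ((hf i).2 _ _) 2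

/-- Descent of the Lyapunov function along one iteration. -/
theorem lyapunov_algStep_le (hP : P.Admissible) (hN : IsNetwork P A f lam)
    (hS : IsConsistent A S) (hα : 0 < α) (hακ : α ≤ P.κhat₀) (flow : ℝ) :
    lyapunov (laplacian A) lam f P.β P.γ flow
        (algStep (laplacian A) f Cmp α P.β P.γ P.ω s S).x
        (algStep (laplacian A) f Cmp α P.β P.γ P.ω s S).v
      ≤ lyapunov (laplacian A) lam f P.β P.γ flow S.x S.v
        - α * (P.φ₁ - α * P.φ₂) * ∑ i, ‖S.x i - mean S.x‖ ^ 2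
        - 3 / 40 * α * (n * ‖gradient (globalCost f) (mean S.x)‖ ^ 2)
        + α * P.ψ₂ α * ∑ i, ‖nextXhat Cmp P.ω s S i - S.x i‖ ^ 2 := by
  have hn : 0 < n := by linarith [hN.two_le]
  have T := hN.triple
  set S' := algStep (laplacian A) f Cmp α P.β P.γ P.ω s S with hS'
  set x := stack S.x
  set xh := stack (nextXhat Cmp P.ω s S) with hxh
  set w := stack (shiftedDual f P.γ S.x S.v) with hw
  set e := stack (gradDeviation f S.x) with he
  set g := mean (fun i => gradient (f i) (S.x i)) with hg
  set g0 := gradient (globalCost f) (mean S.x) with hg0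
  set h := stack (fun i => gradient (f i) (mean S'.x) - gradient (f i) (mean S.x)) with hh
  have hY := hS.nextY_eq (Cmp := Cmp) P.ω s
  have hmean : mean S'.x = mean S.x - α • g := hS.mean_algStep_x hN α P.β P.γ P.ω s
  -- The shift of the dual variable gives γv + ∇f(x) = γw + e.
  have hx' : stack S'.x = x - α • (P.β • matAct (laplacian A) xh + P.γ • w + e) := by
    rw [← hY]
    ext i : 1
    change S.x i - α • (P.β • nextY (laplacian A) Cmp P.ω s S i + P.γ • S.v i
        + gradient (f i) (S.x i)) = S.x i - α • (P.β • nextY (laplacian A) Cmp P.ω s S i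
        + P.γ • (S.v i + P.γ⁻¹ • gradient (f i) (mean S.x))
        + (gradient (f i) (S.x i) - gradient (f i) (mean S.x)))
    rw [smul_add P.γ, smul_smul, mul_inv_cancel₀ hP.γ_pos.ne', one_smul]
    congr 2
    abel
  have hw' : stack (shiftedDual f P.γ S'.x S'.v)
      = w + (α * P.γ) • matAct (laplacian A) xh + P.γ⁻¹ • h := by
    rw [← hY]
    ext i : 1
    change S.v i + (α * P.γ) • nextY (laplacian A) Cmp P.ω s S i
        + P.γ⁻¹ • gradient (f i) (mean S'.x)
      = S.v i + P.γ⁻¹ • gradient (f i) (mean S.x)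
        + (α * P.γ) • nextY (laplacian A) Cmp P.ω s S i
        + P.γ⁻¹ • (gradient (f i) (mean S'.x) - gradient (f i) (mean S.x))
    rw [smul_sub]
    abel
  have hJw : w - matAct (matE n) w = P.γ⁻¹ • stack (fun _ : Fin n => g0) := by
    rw [sub_matAct_matE, hw, matAct_avgMat, hS.mean_shiftedDual hN]
    rfl
  have he' := norm_gradDeviation_sq_le hN.smooth S.x
  -- The gap between the averaged gradient and the gradient at the mean is the mean part of e, hence
  -- no larger than e.
  have hgg : stack (fun _ : Fin n => g) - stack (fun _ : Fin n => g0) = e - matAct (matE n) e := by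
    rw [sub_matAct_matE, he, matAct_avgMat]
    have : mean (gradDeviation f S.x) = g - g0 := by
      rw [hg0, gradient_globalCost hN.smooth, hg, ← mean_sub]
      rfl
    rw [this]
    rfl
  have hg' : ‖stack (fun _ : Fin n => g) - stack (fun _ : Fin n => g0)‖ ^ 2
      ≤ P.ell ^ 2 * ⟪x, matAct (matE n) x⟫ := by
    rw [hgg]
    have := T.norm_sq_decomp e
    nlinarith [sq_nonneg ‖matAct (matE n) e‖]
  have hh' : ‖h‖ ^ 2 ≤ α ^ 2 * (P.ell ^ 2 * ‖stack (fun _ : Fin n => g)‖ ^ 2) := by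
    rw [norm_stack_const_sq, hh, norm_stack_sq]
    calc _ ≤ ∑ _i : Fin n, (P.ell * (α * ‖g‖)) ^ 2 := by
          refine Finset.sum_le_sum fun i _ => pow_le_pow_left₀ (norm_nonneg _) ?_ 2
          have := (hN.smooth i).2 (mean S'.x) (mean S.x)
          rwa [hmean, sub_sub_cancel_left, norm_neg, norm_smul, Real.norm_of_nonneg hα.le,
            ← hmean] at this
      _ = _ := by simp; ring
  have hφ : n * globalCost f (mean S'.x) - n * flow
      ≤ (n * globalCost f (mean S.x) - n * flow)
        - α * ⟪stack (fun _ : Fin n => g), stack (fun _ : Fin n => g0)⟫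
        + P.ell / 2 * α ^ 2 * ‖stack (fun _ : Fin n => g)‖ ^ 2 := by
    have h1 := (isSmoothCost_globalCost hn hN.smooth).le_quadratic (mean S.x) (-(α • g))
    have h2 : ⟪stack (fun _ : Fin n => g), stack (fun _ : Fin n => g0)⟫ = n * ⟪g0, g⟫ := by
      rw [PiLp.inner_apply]
      simp [real_inner_comm]
    rw [← sub_eq_add_neg, ← hmean, inner_neg_right, inner_smul_right, norm_neg, norm_smul,
      mul_pow, Real.norm_eq_abs, sq_abs] at h1
    rw [h2, norm_stack_const_sq]
    have h3 := mul_le_mul_of_nonneg_left h1 (Nat.cast_nonneg n : (0 : ℝ) ≤ n)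
    linarith
  have key := T.energy_descent hα hP.γ_pos hP.four_mul_γ_le hP.five_div_le hx' hw' hJw he' hg' hh' hφ
  have hZ := T.inner_EF_nonneg w
  -- For α ≤ κ̂₀ the dual and averaged-gradient terms of the descent are favourable and can be
  -- dropped.
  have d3 := mul_nonneg (mul_nonneg hα.le (hP.φ₃_sub_nonneg hακ)) hZ
  have d5 := mul_nonneg (mul_nonneg hα.le (hP.φ₅_sub_nonneg hακ))
    (sq_nonneg ‖stack (fun _ : Fin n => g)‖)
  have hD : ‖xh - x‖ ^ 2 = ∑ i, ‖nextXhat Cmp P.ω s S i - S.x i‖ ^ 2 :=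
    norm_stack_sq fun i => nextXhat Cmp P.ω s S i - S.x i
  rw [hD, norm_stack_const_sq g0, inner_matE_stack S.x] at key
  rw [lyapunov_eq, lyapunov_eq, inner_matE_stack S.x, ← hw]
  linarith

/-- The Lyapunov function dominates the consensus error, the dual error and the cost gap. -/
theorem le_lyapunov (hP : P.Admissible) (hN : IsNetwork P A f lam) (flow : ℝ)
    (x v : Fin n → Vec d) :
    P.ε₁ * (∑ i, ‖x i - mean x‖ ^ 2
        + ⟪stack (shiftedDual f P.γ x v),
          matAct (matF (laplacian A) lam) (stack (shiftedDual f P.γ x v))⟫)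
      + (n * globalCost f (mean x) - n * flow)
      ≤ lyapunov (laplacian A) lam f P.β P.γ flow x v := by
  have T := hN.triple
  have h1 := T.energy_lower_bound hP.τ₁_pos (stack x) (stack (shiftedDual f P.γ x v))
  have h2 := mul_le_mul_of_nonneg_right hP.ε₁_le
    (T.inner_F_nonneg (stack (shiftedDual f P.γ x v)))
  have h3 : (P.β + P.γ) / P.γ = P.τ₁ + 1 := by
    have := hP.γ_pos.ne'
    rw [Params.β]
    field_simp
  rw [lyapunov_eq, h3, ← inner_matE_stack]
  rw [← Params.ε₁] at h1
  linarith

/-- The squared length of one iteration. -/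
theorem norm_algStep_sub_sq_le (hP : P.Admissible) (hN : IsNetwork P A f lam)
    (hS : IsConsistent A S) (α s : ℝ) :
    ∑ i, ‖(algStep (laplacian A) f Cmp α P.β P.γ P.ω s S).x i - S.x i‖ ^ 2
      ≤ α ^ 2 * (4 * (P.β ^ 2 * P.rho ^ 2) * ∑ i, ‖nextXhat Cmp P.ω s S i - S.x i‖ ^ 2
        + 4 * max (P.β ^ 2 * P.rho ^ 2 + P.ell ^ 2) (P.γ ^ 2 * P.rho)
          * (∑ i, ‖S.x i - mean S.x‖ ^ 2
            + ⟪stack (shiftedDual f P.γ S.x S.v),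
              matAct (matF (laplacian A) lam) (stack (shiftedDual f P.γ S.x S.v))⟫)) := by
  have T := hN.triple
  set x := stack S.x
  set xh := stack (nextXhat Cmp P.ω s S) with hxh
  set w := stack (shiftedDual f P.γ S.x S.v) with hw
  set e := stack (gradDeviation f S.x) with he
  have hY := hS.nextY_eq (Cmp := Cmp) P.ω s
  have hx' : (stack fun i => (algStep (laplacian A) f Cmp α P.β P.γ P.ω s S).x i - S.x i)
      = (-α) • (P.β • matAct (laplacian A) (xh - x) + P.β • matAct (laplacian A) x
          + P.γ • w + e) := by
    rw [← smul_add P.β, ← map_add, sub_add_cancel, ← hY]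
    ext i : 1
    change S.x i - α • (P.β • nextY (laplacian A) Cmp P.ω s S i + P.γ • S.v i
        + gradient (f i) (S.x i)) - S.x i = (-α) • (P.β • nextY (laplacian A) Cmp P.ω s S i
        + P.γ • (S.v i + P.γ⁻¹ • gradient (f i) (mean S.x))
        + (gradient (f i) (S.x i) - gradient (f i) (mean S.x)))
    rw [smul_add P.γ, smul_smul, mul_inv_cancel₀ hP.γ_pos.ne', one_smul]
    module
  have hL : ∀ z, ‖matAct (laplacian A) z‖ ^ 2 ≤ P.rho ^ 2 * ‖matAct (matE n) z‖ ^ 2 := fun z => by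
    have h1 := T.bounded z
    have h2 := mul_le_mul_of_nonneg_left (T.inner_L_le z) hP.rho_pos.le
    linarith
  have h1 := norm_add_four_sq_le (P.β • matAct (laplacian A) (xh - x))
    (P.β • matAct (laplacian A) x) (P.γ • w) e
  rw [norm_smul, norm_smul, norm_smul, mul_pow, mul_pow, mul_pow, Real.norm_eq_abs,
    Real.norm_eq_abs, sq_abs, sq_abs] at h1
  have h2 := mul_le_mul_of_nonneg_left ((hL (xh - x)).trans
    (mul_le_mul_of_nonneg_left (T.norm_E_sq_le _) (sq_nonneg _))) (sq_nonneg P.β)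
  have h3 := mul_le_mul_of_nonneg_left (hL x) (sq_nonneg P.β)
  have h4 := mul_le_mul_of_nonneg_left (T.norm_sq_le_inner_F w) (sq_nonneg P.γ)
  have h5 := norm_gradDeviation_sq_le hN.smooth S.x
  have hX : ⟪x, matAct (matE n) x⟫ = ‖matAct (matE n) x‖ ^ 2 := T.inner_E x
  have hX' : ⟪x, matAct (matE n) x⟫ = ∑ i, ‖S.x i - mean S.x‖ ^ 2 := inner_matE_stack S.x
  have hD : ‖xh - x‖ ^ 2 = ∑ i, ‖nextXhat Cmp P.ω s S i - S.x i‖ ^ 2 :=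
    norm_stack_sq fun i => nextXhat Cmp P.ω s S i - S.x i
  have hX0 : 0 ≤ ⟪x, matAct (matE n) x⟫ := by rw [hX]; positivity
  have h6 := mul_le_mul_of_nonneg_right
    (le_max_left (P.β ^ 2 * P.rho ^ 2 + P.ell ^ 2) (P.γ ^ 2 * P.rho)) hX0
  have h7 := mul_le_mul_of_nonneg_right
    (le_max_right (P.β ^ 2 * P.rho ^ 2 + P.ell ^ 2) (P.γ ^ 2 * P.rho)) (T.inner_F_nonneg w)
  rw [← norm_stack_sq, hx', norm_smul, mul_pow, norm_neg, Real.norm_eq_abs, sq_abs, ← hD, ← hX']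
  refine mul_le_mul_of_nonneg_left (h1.trans ?_) (sq_nonneg α)
  rw [← hX] at h3
  linarith

end Step

/-! ### Stepsize and scaling factors -/

section Tuning

/-- What the lower bound on the number of iterations says about the stepsize `α`. -/
structure IsTuned (P : Params) (n T : ℕ) (dt L0 κ α : ℝ) : Prop where
  α_pos : 0 < α
  α_le : α ≤ P.κhat₀
  sq_mul : α ^ 2 * (√(n : ℝ) * dt ^ 2 * T) = 1
  ψ₃_le : (1 - 2 * P.ε₅) * P.ψ₃ * (α ^ 2 * (n * dt ^ 2)) ≤ P.ε₈
  L0_le : P.ψ₄ * L0 * α ^ 2 / P.C ^ 2 ≤ P.ε₈ * P.s₀ ^ 2 / 2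
  ψ₂_le : 2 * ((1 - 2 * P.ε₅) * P.ψ₂ α * P.ψ₄ * (α * √(n : ℝ))) ≤ P.ε₈
  κ_le : κ * (α * dt ^ 2) ^ 2 ≤ 1

variable {P : Params} {n T : ℕ} {dt L0 κ α : ℝ}

lemma stepsize_sq_mul (hn : 0 < n) (hdt : 0 < dt) (hT : 0 < T) :
    stepsize n dt T ^ 2 * (√(n : ℝ) * dt ^ 2 * T) = 1 := by
  have hn' : (0 : ℝ) < n := by exact_mod_cast hn
  have hT' : (0 : ℝ) < T := by exact_mod_cast hT
  have h1 : ((n : ℝ) ^ (1 / 4 : ℝ)) ^ 2 = √(n : ℝ) := by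
    rw [← Real.rpow_natCast, ← Real.rpow_mul hn'.le, Real.sqrt_eq_rpow]
    norm_num
  rw [stepsize, div_pow, one_pow, mul_pow, mul_pow, h1, Real.sq_sqrt hT'.le]
  exact one_div_mul_cancel (by positivity)

theorem isTuned_stepsize (hP : P.Admissible) (hn : 0 < n) (hdt : 1 ≤ dt) (hκ : 0 < κ)
    (hT : P.κtilde₃ n dt κ L0 T < T) : 0 < T ∧ IsTuned P n T dt L0 κ (stepsize n dt T) := by
  have hn' : (0 : ℝ) < n := by exact_mod_cast hn
  have hdt' : 0 < dt := by linarith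
  rw [Params.κtilde₃, max_lt_iff, max_lt_iff, max_lt_iff, max_lt_iff] at hT
  obtain ⟨h1, h2, h3, h4, h5⟩ := hT
  -- The last threshold is nonnegative, so it already excludes T = 0.
  have hT' : (0 : ℝ) < T := lt_of_le_of_lt (by positivity) h5
  have hTn : 0 < T := by exact_mod_cast hT'
  have hα : 0 < stepsize n dt T := by
    unfold stepsize
    positivity
  have hsq := stepsize_sq_mul hn hdt' hTn
  refine ⟨hTn, ?_⟩
  generalize stepsize n dt T = α at *
  have hN : 0 < √(n : ℝ) := Real.sqrt_pos.2 hn'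
  have hNN : √(n : ℝ) ^ 2 = n := Real.sq_sqrt hn'.le
  set N := √(n : ℝ)
  have hε₈ := hP.ε₈_pos
  have hC := hP.C_pos
  have hs₀ := hP.s₀_pos
  have hκ₇ : 0 < P.κ₇ := lt_min hP.κhat₀_pos (one_div_pos.2 (mul_pos two_pos hP.ell_pos))
  -- Each threshold K < T is multiplied by a multiple of α² or divided by T; `hsq` then eliminates
  -- T.
  refine ⟨hα, ?_, hsq, ?_, ?_, ?_, ?_⟩
  · rw [div_lt_iff₀ (by positivity)] at h1
    have h6 : α ^ 2 * 1 < α ^ 2 * (T * (N * dt ^ 2 * P.κ₇ ^ 2)) := by gcongr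
    have h7 : α ^ 2 * (T * (N * dt ^ 2 * P.κ₇ ^ 2)) = P.κ₇ ^ 2 := by
      linear_combination P.κ₇ ^ 2 * hsq
    rw [h7, mul_one] at h6
    exact ((pow_lt_pow_iff_left₀ hα.le hκ₇.le two_ne_zero).1 h6).le.trans (min_le_left _ _)
  · rw [div_mul_eq_mul_div, div_lt_iff₀ hε₈] at h2
    refine le_of_mul_le_mul_right ?_ hT'
    have h6 : (1 - 2 * P.ε₅) * P.ψ₃ * (α ^ 2 * (n * dt ^ 2)) * T = (1 - 2 * P.ε₅) * P.ψ₃ * N := by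
      rw [← hNN]
      linear_combination ((1 - 2 * P.ε₅) * P.ψ₃ * N) * hsq
    linarith
  · rw [div_mul_div_comm, div_lt_iff₀ (by positivity)] at h3
    rw [div_le_iff₀ (by positivity)]
    refine le_of_mul_le_mul_right ?_ (by positivity : 0 < 2 * N)
    have h6 := mul_le_mul_of_nonneg_left h3.le (sq_nonneg α)
    have h7 : α ^ 2 * (T * (P.ε₈ * P.C ^ 2 * P.s₀ ^ 2 * n * dt ^ 2))
        = P.ε₈ * P.C ^ 2 * P.s₀ ^ 2 * N := by
      rw [← hNN]
      linear_combination (P.ε₈ * P.C ^ 2 * P.s₀ ^ 2 * N) * hsq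
    linarith
  · rw [div_mul_div_comm, div_lt_iff₀ (by positivity)] at h4
    refine le_of_sq_le_sq ?_ hε₈.le
    have h6 := mul_le_mul_of_nonneg_left h4.le (by positivity : 0 ≤ α ^ 2 * N)
    have h7 : α ^ 2 * N * (T * (P.ε₈ ^ 2 * dt ^ 2)) = P.ε₈ ^ 2 := by
      linear_combination P.ε₈ ^ 2 * hsq
    linarith
  · rw [div_lt_iff₀ hN] at h5
    have h6 := mul_le_mul_of_nonneg_left h5.le (by positivity : 0 ≤ α ^ 2 * dt ^ 2)
    linarith

/-- The normalization α²√n d̃²T = 1 turns n d̃²α³T into α√n, the quantity bounded by `ψ₂_le`. -/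
lemma IsTuned.κtilde₄_eq (h : IsTuned P n T dt L0 κ (stepsize n dt T)) :
    P.κtilde₄ n dt L0 T = P.ψ₄ * L0 * stepsize n dt T ^ 2 / P.C ^ 2
      + (1 - 2 * P.ε₅) * P.ψ₂ (stepsize n dt T) * P.ψ₄ * (stepsize n dt T * √(n : ℝ))
        * P.s₀ ^ 2 := by
  have hNN : √(n : ℝ) ^ 2 = n := Real.sq_sqrt (Nat.cast_nonneg n)
  have hsq := h.sq_mul
  rw [Params.κtilde₄]
  generalize stepsize n dt T = α at *
  generalize √(n : ℝ) = N at *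
  rw [← hNN]
  linear_combination ((1 - 2 * P.ε₅) * P.ψ₂ α * P.ψ₄ * (α * N) * P.s₀ ^ 2) * hsq

section Scaling

variable (hP : P.Admissible) (hL0 : 0 ≤ L0) (h : IsTuned P n T dt L0 κ (stepsize n dt T))
include hP h

omit hP in
-- Each summand is at most ε₈s₀²/2. Hence s₀² is a supersolution of the recursion, which keeps s_k ≤
-- s₀.
lemma IsTuned.κtilde₄_le : P.κtilde₄ n dt L0 T ≤ P.ε₈ * P.s₀ ^ 2 := by
  rw [h.κtilde₄_eq]
  have h1 := h.L0_le
  have h2 := mul_le_mul_of_nonneg_right h.ψ₂_le (sq_nonneg P.s₀)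
  linarith

include hL0

lemma IsTuned.κtilde₄_nonneg : 0 ≤ P.κtilde₄ n dt L0 T := by
  rw [h.κtilde₄_eq]
  have h1 := hP.ψ₄_nonneg
  have h2 := hP.ψ₂_nonneg h.α_pos.le
  have h3 := hP.one_sub_two_ε₅_nonneg
  have h4 := h.α_pos
  positivity

lemma IsTuned.scalingSq_pos (k : ℕ) : 0 < P.scalingSq n dt L0 T k := by
  induction k with
  | zero => exact pow_pos hP.s₀_pos 2
  | succ k ih =>
    have h1 := h.κtilde₄_nonneg hP hL0
    have h2 : 0 < (1 - P.ε₈) * P.scalingSq n dt L0 T k :=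
      mul_pos (by linarith [hP.ε₈_le]) ih
    rw [Params.scalingSq]
    linarith

omit hL0 in
lemma IsTuned.scalingSq_le (k : ℕ) : P.scalingSq n dt L0 T k ≤ P.s₀ ^ 2 := by
  induction k with
  | zero => exact le_rfl
  | succ k ih =>
    have h1 := h.κtilde₄_le
    have h2 : (1 - P.ε₈) * P.scalingSq n dt L0 T k ≤ (1 - P.ε₈) * P.s₀ ^ 2 :=
      mul_le_mul_of_nonneg_left ih (by linarith [hP.ε₈_le])
    rw [Params.scalingSq]
    linarith

lemma IsTuned.scaling_sq (k : ℕ) : P.scaling n dt L0 T k ^ 2 = P.scalingSq n dt L0 T k :=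
  Real.sq_sqrt (h.scalingSq_pos hP hL0 k).le

lemma IsTuned.scaling_pos (k : ℕ) : 0 < P.scaling n dt L0 T k :=
  Real.sqrt_pos.2 (h.scalingSq_pos hP hL0 k)

omit h hL0 hP in
-- The recursion, summed, telescopes; this gives the sum of the s_j² without solving for s_k.
lemma sum_scalingSq (k : ℕ) :
    P.ε₈ * ∑ j ∈ Finset.range k, P.scalingSq n dt L0 T j
      = P.s₀ ^ 2 - P.scalingSq n dt L0 T k + k * P.κtilde₄ n dt L0 T := by
  induction k with
  | zero => simp [Params.scalingSq]
  | succ k ih =>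
    rw [Finset.sum_range_succ, mul_add, ih, Params.scalingSq]
    push_cast
    ring

end Scaling

/-- The bound, per agent, for the Lyapunov function along the run. -/
noncomputable def lyapunovBound (P : Params) (κ B : ℝ) : ℝ :=
  2 * |B| + (P.ψ₂ P.κhat₀ * P.C ^ 2 * P.s₀ ^ 2 / √κ
    + P.ψ₂ P.κhat₀ ^ 2 * P.ψ₄ * P.C ^ 2 * P.s₀ ^ 2) / P.ε₈

lemma lyapunovBound_nonneg (hP : P.Admissible) (κ B : ℝ) : 0 ≤ lyapunovBound P κ B := by
  have := hP.ψ₂_nonneg hP.κhat₀_pos.le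
  have := hP.ψ₄_nonneg
  have := hP.ε₈_pos
  unfold lyapunovBound
  positivity

/-- The accumulated compression error is of order `n`. -/
theorem IsTuned.noise_le (hP : P.Admissible) (hκ : 0 < κ) (hL0 : 0 ≤ L0)
    (h : IsTuned P n T dt L0 κ (stepsize n dt T)) {B : ℝ} (hB : L0 ≤ B * n) :
    L0 + stepsize n dt T * P.ψ₂ (stepsize n dt T) * ((1 - 2 * P.ε₅) * (n * dt ^ 2 * P.C ^ 2)
        * ∑ j ∈ Finset.range T, P.scalingSq n dt L0 T j)
      ≤ n * lyapunovBound P κ B := by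
  have hsum := sum_scalingSq (P := P) (n := n) (T := T) (dt := dt) (L0 := L0) T
  have hpos := h.scalingSq_pos hP hL0 T
  rw [h.κtilde₄_eq] at hsum
  generalize P.scalingSq n dt L0 T T = sT at *
  generalize ∑ j ∈ Finset.range T, P.scalingSq n dt L0 T j = σ at *
  have hα := h.α_pos
  have hψm := hP.ψ₂_mono h.α_le
  have hψ0 := hP.ψ₂_nonneg h.α_pos.le
  have hsq := h.sq_mul
  have hψ := h.ψ₂_le
  have hκ' := h.κ_le
  clear h
  have hNN : √(n : ℝ) ^ 2 = n := Real.sq_sqrt (Nat.cast_nonneg n)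
  have hn0 : (0 : ℝ) ≤ n := Nat.cast_nonneg n
  generalize √(n : ℝ) = N at *
  generalize stepsize n dt T = α at *
  have hq0 := hP.one_sub_two_ε₅_nonneg
  have hq1 : 1 - 2 * P.ε₅ ≤ 1 := by linarith [hP.ε₅_pos]
  have hψ4 := hP.ψ₄_nonneg
  have hε := hP.ε₈_pos
  have hC := hP.C_pos
  generalize 1 - 2 * P.ε₅ = q at *
  -- The role of κ̂₃: the initial scale contributes nαd̃²s₀², which is O(n) only if αd̃² is bounded.
  have hαdt : α * dt ^ 2 ≤ 1 / √κ := by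
    rw [le_div_iff₀ (Real.sqrt_pos.2 hκ)]
    refine le_of_sq_le_sq ?_ zero_le_one
    rw [mul_pow, Real.sq_sqrt hκ.le]
    linarith
  have hB' : L0 ≤ |B| * n := hB.trans (mul_le_mul_of_nonneg_right (le_abs_self B) hn0)
  have hψ2m : 0 ≤ P.ψ₂ P.κhat₀ := hψ0.trans hψm
  have t1 : n * (α * dt ^ 2) * (q * P.ψ₂ α) * (P.C ^ 2 * P.s₀ ^ 2)
      ≤ n * (1 / √κ) * (1 * P.ψ₂ P.κhat₀) * (P.C ^ 2 * P.s₀ ^ 2) := by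
    gcongr
  have t2 : q * P.ψ₂ α * P.ψ₄ * (α * N) * L0 ≤ P.ε₈ / 2 * (|B| * n) := by
    refine mul_le_mul (by linarith) hB' hL0 (by positivity)
  have t3 : n * ((q * P.ψ₂ α) ^ 2 * P.ψ₄ * P.s₀ ^ 2 * P.C ^ 2)
      ≤ n * ((1 * P.ψ₂ P.κhat₀) ^ 2 * P.ψ₄ * P.s₀ ^ 2 * P.C ^ 2) := by
    gcongr
  -- The three terms come from s₀² and from the two summands of κ̃₄. The 𝓛_{1,0} term keeps the
  -- small factor α√n, while in the last term the normalization of α cancels T and leaves n.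
  have hmain : P.ε₈ * (α * P.ψ₂ α * (q * (n * dt ^ 2 * P.C ^ 2) * σ))
      ≤ n * (α * dt ^ 2) * (q * P.ψ₂ α) * (P.C ^ 2 * P.s₀ ^ 2)
        + q * P.ψ₂ α * P.ψ₄ * (α * N) * L0
        + n * ((q * P.ψ₂ α) ^ 2 * P.ψ₄ * P.s₀ ^ 2 * P.C ^ 2) := by
    have e1 : P.ε₈ * σ ≤ P.s₀ ^ 2 + T * (P.ψ₄ * L0 * α ^ 2 / P.C ^ 2
        + q * P.ψ₂ α * P.ψ₄ * (α * N) * P.s₀ ^ 2) := by linarith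
    have e2 := mul_le_mul_of_nonneg_left e1
      (by positivity : 0 ≤ α * P.ψ₂ α * (q * (n * dt ^ 2 * P.C ^ 2)))
    have e3 : α * P.ψ₂ α * (q * (n * dt ^ 2 * P.C ^ 2)) * (P.s₀ ^ 2
        + T * (P.ψ₄ * L0 * α ^ 2 / P.C ^ 2 + q * P.ψ₂ α * P.ψ₄ * (α * N) * P.s₀ ^ 2))
        = n * (α * dt ^ 2) * (q * P.ψ₂ α) * (P.C ^ 2 * P.s₀ ^ 2)
        + q * P.ψ₂ α * P.ψ₄ * (α * N) * L0
        + n * ((q * P.ψ₂ α) ^ 2 * P.ψ₄ * P.s₀ ^ 2 * P.C ^ 2) := by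
      rw [← hNN]
      field_simp
      linear_combination (q * P.ψ₂ α * N * P.ψ₄ * α * L0
        + N ^ 2 * (q * P.ψ₂ α) ^ 2 * P.ψ₄ * P.s₀ ^ 2 * P.C ^ 2) * hsq
    linarith
  have hfin : α * P.ψ₂ α * (q * (n * dt ^ 2 * P.C ^ 2) * σ)
      ≤ (n * (1 / √κ) * (1 * P.ψ₂ P.κhat₀) * (P.C ^ 2 * P.s₀ ^ 2) + P.ε₈ / 2 * (|B| * n)
        + n * ((1 * P.ψ₂ P.κhat₀) ^ 2 * P.ψ₄ * P.s₀ ^ 2 * P.C ^ 2)) / P.ε₈ := by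
    rw [le_div_iff₀ hε]
    linarith
  have hexp : (n * (1 / √κ) * (1 * P.ψ₂ P.κhat₀) * (P.C ^ 2 * P.s₀ ^ 2) + P.ε₈ / 2 * (|B| * n)
        + n * ((1 * P.ψ₂ P.κhat₀) ^ 2 * P.ψ₄ * P.s₀ ^ 2 * P.C ^ 2)) / P.ε₈
      = n * (lyapunovBound P κ B - 3 / 2 * |B|) := by
    unfold lyapunovBound
    field_simp
    ring
  have : 0 ≤ n * |B| := by positivity
  rw [hexp] at hfin
  linarith

end Tuning

/-! ### The run of the algorithm -/

section Run

open scoped RealInnerProductSpace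

variable {n d : ℕ}

lemma add_sq_le_of_pos {ε : ℝ} (hε : 0 < ε) (a b : ℝ) :
    (a + b) ^ 2 ≤ (1 + ε) * a ^ 2 + (1 + ε⁻¹) * b ^ 2 := by
  have h : (1 + ε) * a ^ 2 + (1 + ε⁻¹) * b ^ 2 - (a + b) ^ 2 = ε⁻¹ * (ε * a - b) ^ 2 := by
    field_simp
    ring
  have : 0 ≤ ε⁻¹ * (ε * a - b) ^ 2 := by positivity
  linarith

lemma mean_zero : mean (fun _ : Fin n => (0 : Vec d)) = 0 := by simp [mean]

lemma isConsistent_algRun {P : Params} {A : Matrix (Fin n) (Fin n) ℝ} {f : Fin n → Vec d → ℝ}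
    {lam : ℝ} (hN : IsNetwork P A f lam) (Cmp : Vec d → Vec d) (α β γ ω : ℝ) (s : ℕ → ℝ)
    (x0 : Fin n → Vec d) (k : ℕ) :
    IsConsistent A (algRun (laplacian A) f Cmp α β γ ω s x0 k) := by
  induction k with
  | zero =>
    refine ⟨?_, mean_zero⟩
    have h : stack (algRun (laplacian A) f Cmp α β γ ω s x0 0).xhat = 0 := rfl
    rw [h, map_zero]
    rfl
  | succ k ih => exact ih.algStep hN α β γ ω (s k)

/-- The total squared compression error of one iteration. -/
lemma sum_compression_error_le {P : Params} (hP : P.Admissible) {p : ℝ≥0∞} (hp : 1 ≤ p)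
    {Cmp : Vec d → Vec d} (hCmp : IsLocallyBounded p P.r P.C P.δ Cmp) {S : AlgState n d} {s : ℝ}
    (hs : 0 < s) (hS : ∀ i, lpNorm p (S.x i - S.xhat i) ≤ P.C * s) :
    (∀ i, lpNorm p (S.x i - nextXhat Cmp P.ω s S i) ^ 2 ≤ (1 - 2 * P.ε₅) * (P.C ^ 2 * s ^ 2)) ∧
    ∑ i, ‖nextXhat Cmp P.ω s S i - S.x i‖ ^ 2
      ≤ (1 - 2 * P.ε₅) * (n * dTilde p d ^ 2 * P.C ^ 2) * s ^ 2 := by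
  have h1 : ∀ i, lpNorm p (S.x i - nextXhat Cmp P.ω s S i) ^ 2
      ≤ (1 - 2 * P.ε₅) * (P.C ^ 2 * s ^ 2) := by
    intro i
    have h := compression_error hp hP.r_pos hP.C_pos hP.ω_pos hP.ω_le hs hCmp (hS i)
    rw [sub_sub, mul_pow] at h
    exact h
  refine ⟨h1, ?_⟩
  calc _ ≤ ∑ _i : Fin n, dTilde p d ^ 2 * ((1 - 2 * P.ε₅) * (P.C ^ 2 * s ^ 2)) := by
        refine Finset.sum_le_sum fun i _ => ?_
        have h2 := norm_le_dTilde_mul hp (S.x i - nextXhat Cmp P.ω s S i)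
        rw [norm_sub_rev]
        calc _ ≤ (dTilde p d * lpNorm p (S.x i - nextXhat Cmp P.ω s S i)) ^ 2 := by gcongr
          _ = dTilde p d ^ 2 * lpNorm p (S.x i - nextXhat Cmp P.ω s S i) ^ 2 := by ring
          _ ≤ _ := by gcongr; exact h1 i
    _ = _ := by
        simp only [Finset.sum_const, Finset.card_univ, Fintype.card_fin, nsmul_eq_mul]
        ring

/-- The distance from the new iterate to the current estimate. -/
lemma lpNorm_algStep_sub_sq_le {P : Params} (hP : P.Admissible) {A : Matrix (Fin n) (Fin n) ℝ}
    {f : Fin n → Vec d → ℝ} {lam flow : ℝ} (hN : IsNetwork P A f lam) {p : ℝ≥0∞} (hp : 1 ≤ p)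
    (hdh : dHat p d = P.dhat) {Cmp : Vec d → Vec d} {S : AlgState n d} (hS : IsConsistent A S)
    (hflow : ∀ x, flow ≤ globalCost f x) {α s : ℝ} {a : ℝ} {i : Fin n}
    (ha : lpNorm p (S.x i - nextXhat Cmp P.ω s S i) ^ 2 ≤ a) :
    lpNorm p ((algStep (laplacian A) f Cmp α P.β P.γ P.ω s S).x i - nextXhat Cmp P.ω s S i) ^ 2
      ≤ (1 + P.ε₅) * a
        + α ^ 2 * (P.ψ₃ * ∑ i, ‖nextXhat Cmp P.ω s S i - S.x i‖ ^ 2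
          + P.ψ₄ * lyapunov (laplacian A) lam f P.β P.γ flow S.x S.v) := by
  have hε := hP.ε₅_pos
  have hε₁ := hP.ε₁_pos
  set b := (algStep (laplacian A) f Cmp α P.β P.γ P.ω s S).x i - S.x i with hb
  have h1 : (algStep (laplacian A) f Cmp α P.β P.γ P.ω s S).x i - nextXhat Cmp P.ω s S i
      = (S.x i - nextXhat Cmp P.ω s S i) + b := by rw [hb]; abel
  have h2 := lpNorm_add_le hp (S.x i - nextXhat Cmp P.ω s S i) b
  have h3 := lpNorm_nonneg hp (S.x i - nextXhat Cmp P.ω s S i + b)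
  have h4 : lpNorm p b ^ 2 ≤ P.dhat ^ 2 * ‖b‖ ^ 2 := by
    have := lpNorm_le_dHat_mul hp b
    rw [hdh] at this
    rw [← mul_pow]
    exact pow_le_pow_left₀ (lpNorm_nonneg hp b) this 2
  have h5 : ‖b‖ ^ 2
      ≤ ∑ i, ‖(algStep (laplacian A) f Cmp α P.β P.γ P.ω s S).x i - S.x i‖ ^ 2 :=
    Finset.single_le_sum
      (f := fun i => ‖(algStep (laplacian A) f Cmp α P.β P.γ P.ω s S).x i - S.x i‖ ^ 2)
      (fun j _ => sq_nonneg _) (Finset.mem_univ i)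
  have h6 := h5.trans (norm_algStep_sub_sq_le (Cmp := Cmp) hP hN hS α s)
  have h7 := le_lyapunov hP hN flow S.x S.v
  have h8 : (0 : ℝ) ≤ n * globalCost f (mean S.x) - n * flow := by
    rw [← mul_sub]
    exact mul_nonneg (Nat.cast_nonneg n) (sub_nonneg.2 (hflow _))
  set D := ∑ i, ‖nextXhat Cmp P.ω s S i - S.x i‖ ^ 2
  set W := ∑ i, ‖S.x i - mean S.x‖ ^ 2 + ⟪stack (shiftedDual f P.γ S.x S.v),
    matAct (matF (laplacian A) lam) (stack (shiftedDual f P.γ S.x S.v))⟫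
  set V := lyapunov (laplacian A) lam f P.β P.γ flow S.x S.v
  set m := max (P.β ^ 2 * P.rho ^ 2 + P.ell ^ 2) (P.γ ^ 2 * P.rho) with hm
  have hW : P.ε₁ * W ≤ V := by linarith
  -- ψ₃ and ψ₄ contain the Young factor 1 + ε₅⁻¹ and the norm conversion d̂²; the division by ε₁ in
  -- ψ₄ replaces W by the Lyapunov value.
  have h9 : (1 + P.ε₅⁻¹) * lpNorm p b ^ 2 ≤ α ^ 2 * (P.ψ₃ * D + P.ψ₄ * V) := by
    calc (1 + P.ε₅⁻¹) * lpNorm p b ^ 2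
        ≤ (1 + P.ε₅⁻¹) * (P.dhat ^ 2
          * (α ^ 2 * (4 * (P.β ^ 2 * P.rho ^ 2) * D + 4 * m * W))) := by
          gcongr
          exact h4.trans (by gcongr)
      _ = α ^ 2 * (P.ψ₃ * D + P.ψ₄ * (P.ε₁ * W)) := by
          rw [Params.ψ₃, Params.ψ₄, ← hm]
          field_simp
      _ ≤ _ := by
          have := hP.ψ₄_nonneg
          gcongr
  rw [h1]
  calc _ ≤ (lpNorm p (S.x i - nextXhat Cmp P.ω s S i) + lpNorm p b) ^ 2 := by gcongr
    _ ≤ (1 + P.ε₅) * lpNorm p (S.x i - nextXhat Cmp P.ω s S i) ^ 2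
        + (1 + P.ε₅⁻¹) * lpNorm p b ^ 2 := add_sq_le_of_pos hε _ _
    _ ≤ _ := by gcongr

/-- Along the run the compressor is only used within its range, and the Lyapunov function plus the
accumulated optimality gap grows at most by the accumulated compression error. -/
theorem algRun_bounds {P : Params} (hP : P.Admissible) {A : Matrix (Fin n) (Fin n) ℝ}
    {f : Fin n → Vec d → ℝ} {lam flow : ℝ} (hN : IsNetwork P A f lam) {p : ℝ≥0∞} (hp : 1 ≤ p)
    (hdh : dHat p d = P.dhat) {Cmp : Vec d → Vec d}
    (hCmp : IsLocallyBounded p P.r P.C P.δ Cmp) (hflow : ∀ x, flow ≤ globalCost f x)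
    {x0 : Fin n → Vec d} (hx0 : ∀ i, lpNorm p (x0 i) / P.C ≤ P.s₀) {L0 κ : ℝ} {T : ℕ}
    (hL0 : 0 ≤ L0)
    (hL0_eq : L0 = lyapunov (laplacian A) lam f P.β P.γ flow x0 (fun _ => 0))
    (ht : IsTuned P n T (dTilde p d) L0 κ (stepsize n (dTilde p d) T))
    {run : ℕ → AlgState n d} (hrun : run = algRun (laplacian A) f Cmp
      (stepsize n (dTilde p d) T) P.β P.γ P.ω (P.scaling n (dTilde p d) L0 T) x0)
    (k : ℕ) (hk : k ≤ T) :
    (∀ i, lpNorm p ((run k).x i - (run k).xhat i) ≤ P.C * P.scaling n (dTilde p d) L0 T k) ∧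
    lyapunov (laplacian A) lam f P.β P.γ flow (run k).x (run k).v
      + ∑ j ∈ Finset.range k,
        (stepsize n (dTilde p d) T * (P.φ₁ - stepsize n (dTilde p d) T * P.φ₂)
            * ∑ i, ‖(run j).x i - mean (run j).x‖ ^ 2
          + 3 / 40 * stepsize n (dTilde p d) T
            * (n * ‖gradient (globalCost f) (mean (run j).x)‖ ^ 2))
      ≤ L0 + stepsize n (dTilde p d) T * P.ψ₂ (stepsize n (dTilde p d) T)
        * ((1 - 2 * P.ε₅) * (n * dTilde p d ^ 2 * P.C ^ 2)
          * ∑ j ∈ Finset.range k, P.scalingSq n (dTilde p d) L0 T j) := by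
  have hcons : ∀ k, IsConsistent A (run k) := fun k => by
    rw [hrun]
    exact isConsistent_algRun hN _ _ _ _ _ _ _ _
  have hstep : ∀ k, run (k + 1) = algStep (laplacian A) f Cmp (stepsize n (dTilde p d) T)
      P.β P.γ P.ω (P.scaling n (dTilde p d) L0 T k) (run k) := fun k => by rw [hrun]; rfl
  set dt := dTilde p d with hdt
  set α := stepsize n dt T with hα_def
  have hα := ht.α_pos
  have hψ₂ := hP.ψ₂_nonneg hα.le
  have hψ₃ := hP.ψ₃_nonneg
  have hψ₄ := hP.ψ₄_nonneg
  have hq := hP.one_sub_two_ε₅_nonneg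
  have hC := hP.C_pos
  induction k with
  | zero =>
    have h0 : run 0 = ⟨x0, fun _ => 0, fun _ => 0, fun _ => 0⟩ := by rw [hrun]; rfl
    have hs0 : P.scaling n dt L0 T 0 = P.s₀ := Real.sqrt_sq hP.s₀_pos.le
    refine ⟨fun i => ?_, ?_⟩
    · rw [h0, hs0, mul_comm, ← div_le_iff₀ hC]
      simpa using hx0 i
    · rw [h0]
      simp [hL0_eq]
  | succ k ih =>
    obtain ⟨ih1, ih2⟩ := ih (by omega)
    have hkT : (k : ℝ) ≤ T := by exact_mod_cast (by omega : k ≤ T)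
    have hs := ht.scaling_pos hP hL0 k
    obtain ⟨hc1, hc2⟩ := sum_compression_error_le hP hp hCmp hs ih1
    rw [ht.scaling_sq hP hL0 k] at hc1 hc2
    have hdesc := lyapunov_algStep_le (Cmp := Cmp) (s := P.scaling n dt L0 T k) hP hN (hcons k)
      hα ht.α_le flow
    rw [← hstep k] at hdesc
    set D := ∑ i, ‖nextXhat Cmp P.ω (P.scaling n dt L0 T k) (run k) i - (run k).x i‖ ^ 2
    refine ⟨fun i => ?_, ?_⟩
    · have h1 := lpNorm_algStep_sub_sq_le (α := α) hP hN hp hdh (hcons k) hflow (hc1 i)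
      rw [← hstep k] at h1
      have hxh : (run (k + 1)).xhat i
          = nextXhat Cmp P.ω (P.scaling n dt L0 T k) (run k) i := by rw [hstep k]; rfl
      rw [← hxh] at h1
      refine le_of_sq_le_sq ?_ (mul_pos hC (ht.scaling_pos hP hL0 (k + 1))).le
      rw [mul_pow, ht.scaling_sq hP hL0, Params.scalingSq]
      refine h1.trans ?_
      set V := lyapunov (laplacian A) lam f P.β P.γ flow (run k).x (run k).v
      have hsk := (ht.scalingSq_pos hP hL0 k).le
      -- Bounding every s_j by s₀ and k by T makes the estimate independent of k, so that one
      -- constant κ̃₄ drives the whole recursion.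
      have hV : V ≤ L0 + α * P.ψ₂ α * ((1 - 2 * P.ε₅) * (n * dt ^ 2 * P.C ^ 2)
          * (T * P.s₀ ^ 2)) := by
        have hsum : ∑ j ∈ Finset.range k, P.scalingSq n dt L0 T j ≤ T * P.s₀ ^ 2 := by
          calc _ ≤ ∑ _j ∈ Finset.range k, P.s₀ ^ 2 :=
                Finset.sum_le_sum fun j _ => ht.scalingSq_le hP j
            _ = k * P.s₀ ^ 2 := by simp
            _ ≤ _ := by gcongr
        have hgap : 0 ≤ ∑ j ∈ Finset.range k,
            (α * (P.φ₁ - α * P.φ₂) * ∑ i, ‖(run j).x i - mean (run j).x‖ ^ 2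
              + 3 / 40 * α * (n * ‖gradient (globalCost f) (mean (run j).x)‖ ^ 2)) := by
          have := hP.φ₁_sub_nonneg ht.α_le
          exact Finset.sum_nonneg fun j _ => by positivity
        have : α * P.ψ₂ α * ((1 - 2 * P.ε₅) * (n * dt ^ 2 * P.C ^ 2)
            * ∑ j ∈ Finset.range k, P.scalingSq n dt L0 T j)
            ≤ α * P.ψ₂ α * ((1 - 2 * P.ε₅) * (n * dt ^ 2 * P.C ^ 2) * (T * P.s₀ ^ 2)) := by
          gcongr
        linarith
      -- The identity that defines ε₈: one of the two ε₈ pays for `e2`, the other remains as the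
      -- contraction of s_k².
      have e1 : (1 + P.ε₅) * (1 - 2 * P.ε₅) = 1 - 2 * P.ε₈ := by
        rw [Params.ε₈]
        ring
      have e2 : α ^ 2 * (P.ψ₃ * D) ≤ P.ε₈ * (P.C ^ 2 * P.scalingSq n dt L0 T k) := by
        calc _ ≤ α ^ 2 * (P.ψ₃ * ((1 - 2 * P.ε₅) * (n * dt ^ 2 * P.C ^ 2)
              * P.scalingSq n dt L0 T k)) := by gcongr
          _ = (1 - 2 * P.ε₅) * P.ψ₃ * (α ^ 2 * (n * dt ^ 2))
              * (P.C ^ 2 * P.scalingSq n dt L0 T k) := by ring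
          _ ≤ _ := by gcongr; exact ht.ψ₃_le
      have e3 : α ^ 2 * (P.ψ₄ * V) ≤ P.C ^ 2 * P.κtilde₄ n dt L0 T := by
        calc _ ≤ α ^ 2 * (P.ψ₄ * (L0 + α * P.ψ₂ α * ((1 - 2 * P.ε₅) * (n * dt ^ 2 * P.C ^ 2)
              * (T * P.s₀ ^ 2)))) := by gcongr
          _ = _ := by
              rw [Params.κtilde₄, ← hα_def]
              field_simp
      have e4 : (1 + P.ε₅) * ((1 - 2 * P.ε₅) * (P.C ^ 2 * P.scalingSq n dt L0 T k))
          = (1 - 2 * P.ε₈) * (P.C ^ 2 * P.scalingSq n dt L0 T k) := by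
        rw [← mul_assoc, e1]
      rw [e4]
      linarith
    · rw [Finset.sum_range_succ, Finset.sum_range_succ]
      have h2 := mul_le_mul_of_nonneg_left hc2 (mul_nonneg hα.le hψ₂)
      linarith

/-- The Lyapunov function plus the accumulated optimality gap stays of order `n`. -/
theorem algRun_lyapunov_le {P : Params} (hP : P.Admissible) {A : Matrix (Fin n) (Fin n) ℝ}
    {f : Fin n → Vec d → ℝ} {lam flow : ℝ} (hN : IsNetwork P A f lam) {p : ℝ≥0∞} (hp : 1 ≤ p)
    (hdh : dHat p d = P.dhat) {Cmp : Vec d → Vec d}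
    (hCmp : IsLocallyBounded p P.r P.C P.δ Cmp) (hflow : ∀ x, flow ≤ globalCost f x)
    {x0 : Fin n → Vec d} (hx0 : ∀ i, lpNorm p (x0 i) / P.C ≤ P.s₀) {L0 κ B : ℝ} {T : ℕ}
    (hL0 : 0 ≤ L0) (hκ : 0 < κ) (hB : L0 ≤ B * n)
    (hL0_eq : L0 = lyapunov (laplacian A) lam f P.β P.γ flow x0 (fun _ => 0))
    (ht : IsTuned P n T (dTilde p d) L0 κ (stepsize n (dTilde p d) T))
    {run : ℕ → AlgState n d} (hrun : run = algRun (laplacian A) f Cmp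
      (stepsize n (dTilde p d) T) P.β P.γ P.ω (P.scaling n (dTilde p d) L0 T) x0)
    (k : ℕ) (hk : k ≤ T) :
    lyapunov (laplacian A) lam f P.β P.γ flow (run k).x (run k).v
      + ∑ j ∈ Finset.range k,
        (stepsize n (dTilde p d) T * (P.φ₁ - stepsize n (dTilde p d) T * P.φ₂)
            * ∑ i, ‖(run j).x i - mean (run j).x‖ ^ 2
          + 3 / 40 * stepsize n (dTilde p d) T
            * (n * ‖gradient (globalCost f) (mean (run j).x)‖ ^ 2))
      ≤ n * lyapunovBound P κ B := by
  refine ((algRun_bounds hP hN hp hdh hCmp hflow hx0 hL0 hL0_eq ht hrun k hk).2.trans ?_).trans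
    (ht.noise_le hP hκ hL0 hB)
  have h1 : ∑ j ∈ Finset.range k, P.scalingSq n (dTilde p d) L0 T j
      ≤ ∑ j ∈ Finset.range T, P.scalingSq n (dTilde p d) L0 T j :=
    Finset.sum_le_sum_of_subset_of_nonneg (Finset.range_mono hk)
      fun j _ _ => (ht.scalingSq_pos hP hL0 j).le
  have hα := ht.α_pos.le
  have hψ₂ := hP.ψ₂_nonneg hα
  have hq := hP.one_sub_two_ε₅_nonneg
  have h2 : 0 ≤ (1 - 2 * P.ε₅) * (n * dTilde p d ^ 2 * P.C ^ 2) := by positivity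
  exact add_le_add_right (mul_le_mul_of_nonneg_left (mul_le_mul_of_nonneg_left h1 h2)
    (mul_nonneg hα hψ₂)) _

end Run

/-! ### Averaging and conclusion -/

/-- Averaging a summed descent inequality. If the stepsize `α` is close to its upper limit `κ`, so
that the coefficient of `X` degenerates, the termwise bounds take over. -/
lemma average_le_of_descent {T : ℕ} {N α κ φ₁ φ₂ M a b : ℝ} {X G : ℕ → ℝ} (hT : 0 < T)
    (hN : 0 < N) (hα : 0 < α) (hκ : 0 < κ) (hφ₁ : 0 < φ₁) (hφ₂ : 0 < φ₂) (hφ : κ * φ₂ ≤ φ₁)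
    (hαT : α ≤ 1 / (α * T)) (hM : 0 ≤ M) (ha : 0 ≤ a) (hb : 0 ≤ b)
    (hX : ∀ k, 0 ≤ X k) (hG : ∀ k, 0 ≤ G k)
    (hGk : ∀ k < T, G k ≤ a * M) (hXk : ∀ k < T, 1 / N * X k ≤ b * M)
    (hsum : ∑ j ∈ Finset.range T,
      (α * (φ₁ - α * φ₂) * X j + 3 / 40 * α * (N * G j)) ≤ N * M) :
    1 / (T : ℝ) * ∑ k ∈ Finset.range T, (G k + 1 / N * X k)
      ≤ M * (1 + 1 / min (φ₁ / 2) (3 / 40) + (a + b) * (2 / κ)) * (1 / (α * T)) := by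
  have hT' : (0 : ℝ) < T := by exact_mod_cast hT
  obtain ⟨c, hc_eq⟩ : ∃ c, c = min (φ₁ / 2) (3 / 40) := ⟨_, rfl⟩
  rw [← hc_eq]
  have hc : 0 < c := by
    rw [hc_eq]
    exact lt_min (half_pos hφ₁) (by norm_num)
  have hc1 : c ≤ φ₁ / 2 := hc_eq ▸ min_le_left _ _
  have hc2 : c ≤ 3 / 40 := hc_eq ▸ min_le_right _ _
  have hK1 : 0 ≤ M * (1 / c) := by positivity
  have hK2 : 0 ≤ M * ((a + b) * (2 / κ)) := by positivity
  have hα0 : 0 ≤ 1 / (α * T) := by positivity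
  -- For α ≤ κ/2 the coefficient of X is at least φ₁/2, so the summed inequality can be divided by
  -- αT. Otherwise 1/(αT) ≥ α ≥ κ/2, so the target rate is bounded below and termwise bounds
  -- suffice.
  rcases le_total α (κ / 2) with hsmall | hlarge
  · have hcoef : c ≤ φ₁ - α * φ₂ := by
      have h2 := mul_le_mul_of_nonneg_right hsmall hφ₂.le
      linarith
    have h1 : N * (α * c * ∑ k ∈ Finset.range T, (G k + 1 / N * X k)) ≤ N * M := by
      refine le_trans ?_ hsum
      rw [Finset.mul_sum, Finset.mul_sum]
      refine Finset.sum_le_sum fun k _ => ?_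
      have e : N * (α * c * (G k + 1 / N * X k)) = α * c * X k + c * α * (N * G k) := by
        field_simp
        ring
      have h3 := mul_le_mul_of_nonneg_right (mul_le_mul_of_nonneg_left hcoef hα.le) (hX k)
      have h4 := mul_le_mul_of_nonneg_right (mul_le_mul_of_nonneg_right hc2 hα.le)
        (mul_nonneg hN.le (hG k))
      rw [e]
      exact add_le_add h3 h4
    have h2 := le_of_mul_le_mul_left h1 hN
    have hsum' : ∑ k ∈ Finset.range T, (G k + 1 / N * X k) ≤ M / (α * c) := by
      rw [le_div_iff₀ (by positivity)]
      linarith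
    calc _ ≤ 1 / (T : ℝ) * (M / (α * c)) := mul_le_mul_of_nonneg_left hsum' (by positivity)
      _ = M * (1 / c) * (1 / (α * T)) := by field_simp
      _ ≤ _ := mul_le_mul_of_nonneg_right (by linarith) hα0
  · calc _ ≤ 1 / (T : ℝ) * ∑ _k ∈ Finset.range T, (a + b) * M := by
          refine mul_le_mul_of_nonneg_left (Finset.sum_le_sum fun k hk => ?_) (by positivity)
          have hkT := Finset.mem_range.1 hk
          linarith [hGk k hkT, hXk k hkT]
      _ = M * ((a + b) * (2 / κ)) * (κ / 2) := by
          rw [Finset.sum_const, Finset.card_range, nsmul_eq_mul]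
          field_simp
      _ ≤ M * ((a + b) * (2 / κ)) * (1 / (α * T)) :=
          mul_le_mul_of_nonneg_left (hlarge.trans hαT) hK2
      _ ≤ _ := mul_le_mul_of_nonneg_right (by linarith) hα0

lemma rate_eq_one_div_stepsize_mul {n T : ℕ} {dt : ℝ} (hn : 0 < n) (hT : 0 < T) (hdt : 0 < dt) :
    (n : ℝ) ^ (1 / 4 : ℝ) * dt / √(T : ℝ) = 1 / (stepsize n dt T * T) := by
  have hT' : (0 : ℝ) < T := by exact_mod_cast hT
  have hn' : (0 : ℝ) < n := by exact_mod_cast hn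
  have hTT : √(T : ℝ) ^ 2 = T := Real.sq_sqrt hT'.le
  have h1 : 0 < √(T : ℝ) := Real.sqrt_pos.2 hT'
  have h2 : 0 < (n : ℝ) ^ (1 / 4 : ℝ) := Real.rpow_pos_of_pos hn' _
  rw [stepsize]
  generalize √(T : ℝ) = t at *
  rw [← hTT]
  field_simp

theorem theorem1 (P : Params) (κhat₃ B : ℝ)
    (hell : 0 < P.ell) (hr : 0 < P.r) (hC : 0 < P.C) (hδ : 0 < P.δ ∧ P.δ ≤ 1)
    (hω : 0 < P.ω ∧ P.ω ≤ 1 / P.r) (hs₀ : 0 < P.s₀)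
    (hτ₁ : P.κ₁ ≤ P.τ₁) (hγ : P.κ₂ < P.γ) (hκhat₀ : 0 < P.κhat₀) (hκhat₃ : 0 < κhat₃) :
    ∃ M : ℝ, ∀ (n d T : ℕ) (p : ENNReal) (A : Matrix (Fin n) (Fin n) ℝ)
      (Cmp : Vec d → Vec d) (f : Fin n → Vec d → ℝ) (flow lam : ℝ) (x0 : Fin n → Vec d)
      (L0 : ℝ) (run : ℕ → AlgState n d),
      2 ≤ n → 1 ≤ d → 1 ≤ p → dHat p d = P.dhat →
      IsLocallyBounded p P.r P.C P.δ Cmp →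
      IsUndirectedConnected A →
      rhoMax (laplacian A) = P.rho → rhoTwo (laplacian A) = P.rho2 →
      lam ∈ Set.Icc P.rho2 P.rho →
      (∀ i, IsSmoothCost P.ell (f i)) →
      BddBelow (Set.range (globalCost f)) →
      flow ≤ ⨅ x, globalCost f x →
      (∀ i, lpNorm p (x0 i) / P.C ≤ P.s₀) →
      L0 = lyapunov (laplacian A) lam f P.β P.γ flow x0 (fun _ => 0) →
      L0 ≤ B * n →
      P.κtilde₃ n (dTilde p d) κhat₃ L0 T < T →
      run = algRun (laplacian A) f Cmp (stepsize n (dTilde p d) T) P.β P.γ P.ω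
        (P.scaling n (dTilde p d) L0 T) x0 →
      (1 / (T : ℝ)) * ∑ k ∈ Finset.range T,
          (‖gradient (globalCost f) (mean (run k).x)‖ ^ 2
            + (1 / (n : ℝ)) * ∑ i, ‖(run k).x i - mean (run k).x‖ ^ 2)
        ≤ M * ((n : ℝ) ^ (1 / 4 : ℝ) * dTilde p d / √(T : ℝ))
      ∧ globalCost f (mean (run T).x) - ⨅ x, globalCost f x ≤ M := by
  -- The summand 1 serves the cost gap, the second the regime α ≤ κ̂₀/2, and the third the regime of
  -- larger α. There 2ℓ and 1/ε₁ bound a single squared gradient and a single consensus error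
  -- relative to the per-agent Lyapunov bound.
  refine ⟨lyapunovBound P κhat₃ B * (1 + 1 / min (P.φ₁ / 2) (3 / 40)
    + (2 * P.ell + 1 / P.ε₁) * (2 / P.κhat₀)), ?_⟩
  intro n d T p A Cmp f flow lam x0 L0 run hn hd hp hdh hCmp hA hρ hρ₂ hlam hf hbdd hflow hx0
    hL0_eq hB hT hrun
  have hP : P.Admissible :=
    ⟨hell, hr, hC, hδ.1, hδ.2, hω.1, hω.2, hs₀, hτ₁, hγ, hκhat₀, hρ₂ ▸ rhoTwo_pos hA hn,
      hlam.1.trans hlam.2⟩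
  have hN : IsNetwork P A f lam := ⟨hn, hA, hρ, hρ₂, hlam, hf⟩
  have hflow' : ∀ x, flow ≤ globalCost f x := fun x => hflow.trans (ciInf_le hbdd x)
  have hnpos : 0 < n := by omega
  have hn0 : (0 : ℝ) < n := by exact_mod_cast hnpos
  have hε₁ := hP.ε₁_pos
  have hX : ∀ x : Fin n → Vec d, 0 ≤ ∑ i, ‖x i - mean x‖ ^ 2 := fun x =>
    Finset.sum_nonneg fun i _ => sq_nonneg _
  have hgap : ∀ x : Fin n → Vec d, 0 ≤ n * globalCost f (mean x) - n * flow := fun x => by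
    rw [← mul_sub]
    exact mul_nonneg hn0.le (sub_nonneg.2 (hflow' _))
  have hlow : ∀ x v : Fin n → Vec d, P.ε₁ * ∑ i, ‖x i - mean x‖ ^ 2
      + (n * globalCost f (mean x) - n * flow)
      ≤ lyapunov (laplacian A) lam f P.β P.γ flow x v := fun x v => by
    have h1 := le_lyapunov hP hN flow x v
    have h2 := mul_nonneg hε₁.le (hN.triple.inner_F_nonneg (stack (shiftedDual f P.γ x v)))
    linarith
  have hV0 : ∀ x v : Fin n → Vec d, 0 ≤ lyapunov (laplacian A) lam f P.β P.γ flow x v :=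
    fun x v => (add_nonneg (mul_nonneg hε₁.le (hX x)) (hgap x)).trans (hlow x v)
  have hL0 : 0 ≤ L0 := hL0_eq ▸ hV0 _ _
  have hdt := one_le_dTilde (p := p) hd
  obtain ⟨hT0, ht⟩ := isTuned_stepsize hP hnpos hdt hκhat₃ hT
  have hcum := algRun_lyapunov_le hP hN hp hdh hCmp hflow' hx0 hL0 hκhat₃ hB hL0_eq ht hrun
  rw [rate_eq_one_div_stepsize_mul hnpos hT0 (by linarith)]
  have hM := lyapunovBound_nonneg hP κhat₃ B
  clear hrun hL0_eq hT
  generalize stepsize n (dTilde p d) T = α at *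
  generalize lyapunovBound P κhat₃ B = M₀ at *
  have hα := ht.α_pos
  have hV : ∀ k ≤ T, lyapunov (laplacian A) lam f P.β P.γ flow (run k).x (run k).v
      ≤ n * M₀ := fun k hk => by
    refine le_trans (le_add_of_nonneg_right ?_) (hcum k hk)
    refine Finset.sum_nonneg fun j _ => ?_
    have h1 := hX (run j).x
    have h2 := hP.φ₁_sub_nonneg ht.α_le
    positivity
  have hfk : ∀ k ≤ T, globalCost f (mean (run k).x) - flow ≤ M₀ := fun k hk => by
    have h1 := (hlow (run k).x (run k).v).trans (hV k hk)
    have h2 := mul_nonneg hε₁.le (hX (run k).x)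
    refine le_of_mul_le_mul_left ?_ hn0
    linarith
  have hκφ : P.κhat₀ * P.φ₂ ≤ P.φ₁ := by linarith [hP.φ₁_sub_nonneg le_rfl]
  have hαT : α ≤ 1 / (α * T) := by
    rw [le_div_iff₀ (by positivity), ← ht.sq_mul]
    have h1 : 1 ≤ √(n : ℝ) := Real.one_le_sqrt.2 (by exact_mod_cast hnpos)
    have h2 : 1 ≤ dTilde p d ^ 2 := one_le_pow₀ hdt
    calc α * (α * T) = α ^ 2 * (1 * 1 * T) := by ring
      _ ≤ _ := by gcongr
  refine ⟨?_, ?_⟩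
  · refine average_le_of_descent
      (X := fun k => ∑ i, ‖(run k).x i - mean (run k).x‖ ^ 2)
      (G := fun k => ‖gradient (globalCost f) (mean (run k).x)‖ ^ 2)
      hT0 hn0 hα hκhat₀ hP.φ₁_pos hP.φ₂_pos hκφ hαT hM (by positivity) (by positivity)
      (fun k => hX _) (fun k => sq_nonneg _) (fun k hk => ?_) (fun k hk => ?_) ?_
    · exact ((isSmoothCost_globalCost hnpos hf).norm_gradient_sq_le hell hflow' _).trans
        (mul_le_mul_of_nonneg_left (hfk k hk.le) (by positivity))
    · have h3 := (hlow (run k).x (run k).v).trans (hV k hk.le)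
      have h4 := hgap (run k).x
      rw [one_div_mul_eq_div, one_div_mul_eq_div, div_le_div_iff₀ hn0 hε₁]
      linarith
    · exact (le_add_of_nonneg_left (hV0 _ _)).trans (hcum T le_rfl)
  · have h1 := hfk T le_rfl
    have hφ₁ := hP.φ₁_pos
    have hmin : 0 < min (P.φ₁ / 2) (3 / 40) := lt_min (half_pos hφ₁) (by norm_num)
    have h2 : M₀ * 1 ≤ M₀ * (1 + 1 / min (P.φ₁ / 2) (3 / 40)
        + (2 * P.ell + 1 / P.ε₁) * (2 / P.κhat₀)) := by
      refine mul_le_mul_of_nonneg_left ?_ hM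
      have h3 : 0 ≤ 1 / min (P.φ₁ / 2) (3 / 40) := by positivity
      have h4 : 0 ≤ (2 * P.ell + 1 / P.ε₁) * (2 / P.κhat₀) := by positivity
      linarith
    linarith
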